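/- For a probability measure $\mu$ on $\mathbb{R}$, let $C_{\mathrm{LS}}(\mu)\in[0,+\infty]$ denote its log-Sobolev constant, i.e. the smallest $C$ such that $$\int h^2\log(h^2)\,d\mu-\Big(\int h^2\,d\mu\Big)\log\Big(\int h^2\,d\mu\Big)\le 2C\int (h')^2\,d\mu$$ for all compactly supported smooth functions $h:\mathbb{R}\to\mathbb{R}$. Let $V:\mathbb{R}\to\mathbb{R}$ be a differentiable function that is bounded below and satisfies a Polyak–Łojasiewicz inequality: there is a constant $C$ such that $V(x)-\inf V\le C\,V'(x)^2$ for all $x\in\mathbb{R}$. Let $a<b$ be real numbers such that the set of global minimizers of $V$ is $[a,b]$. Assume that the restrictions $V|_{(-\infty,a]}$ and $V|_{[b,+\infty)}$ are $C^2$ (up to the endpoints), and that $\dfrac{V''}{1+V'^2}$ is bounded above on $\mathbb{R}\setminus[a,b]$. Let $V''(a^-)$ and $V''(b^+)$ be the one-sided second derivatives of $V$ at $a$ and $b$. For $t>0$ let $\mu_t=\frac1{Z_t}e^{-V/t}\,dx$ with normalizing constant $Z_t=\int_{\mathbb{R}} e^{-V/t}\,dx$, and let $\mu_0$ be the uniform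 probability measure on $[a,b]$. Then $Z_t<\infty$ for every $t>0$, so that $\mu_t$ is a probability measure; $V''(a^-)>0$ and $V''(b^+)>0$; $C_{\mathrm{LS}}(\mu_0)<\infty$ and $C_{\mathrm{LS}}(\mu_t)<\infty$ for all sufficiently small $t>0$; and $$\frac{C_{\mathrm{LS}}(\mu_t)-C_{\mathrm{LS}}(\mu_0)}{\sqrt t}\;\xrightarrow[t\to0^+]{}\;\sqrt2\,(b-a)\,\pi^{-3/2}\Big(V''(a^-)^{-1/2}+V''(b^+)^{-1/2}\Big).$$ -/

import Mathlib

open MeasureTheory Filter Topology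
open scoped ContDiff ENNReal NNReal

/-- The set of global minimizers of `V`. -/
def argmin (V : ℝ → ℝ) : Set ℝ := {x | ∀ y, V x ≤ V y}

/-- `V` is differentiable, bounded below, and satisfies a Polyak-Łojasiewicz inequality
`V - inf V ≤ C |V'|²` on the whole line, for some constant `C`. -/
def PolyakLojasiewicz (V : ℝ → ℝ) : Prop :=
  Differentiable ℝ V ∧ BddBelow (Set.range V) ∧
    ∃ C : ℝ, ∀ x, V x - ⨅ y, V y ≤ C * (deriv V x) ^ 2

/-- The Gibbs measure `μ_t = Z_t⁻¹ exp (-V / t) dx` at temperature `t > 0`. -/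
noncomputable def gibbsMeasure (V : ℝ → ℝ) (t : ℝ) : Measure ℝ :=
  (volume : Measure ℝ).tilted (fun x => -V x / t)

/-- The uniform probability measure on `[a, b]`. -/
noncomputable def uniformMeasure (a b : ℝ) : Measure ℝ :=
  ProbabilityTheory.cond volume (Set.Icc a b)

/-- `Ent_μ(h²) = ∫ h² log h² dμ - (∫ h² dμ) log (∫ h² dμ)`. -/
noncomputable def entropySq (μ : Measure ℝ) (h : ℝ → ℝ) : ℝ :=
  (∫ x, h x ^ 2 * Real.log (h x ^ 2) ∂μ) -
    (∫ x, h x ^ 2 ∂μ) * Real.log (∫ x, h x ^ 2 ∂μ)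

/-- The logarithmic Sobolev inequality with constant `C`, tested on compactly supported
smooth functions. -/
def SatisfiesLSI (μ : Measure ℝ) (C : ℝ) : Prop :=
  ∀ h : ℝ → ℝ, ContDiff ℝ ∞ h → HasCompactSupport h →
    entropySq μ h ≤ 2 * C * ∫ x, (deriv h x) ^ 2 ∂μ

/-- The best constant `C_LS(μ) ∈ [0, ∞]` in the logarithmic Sobolev inequality
(`∞` if there is no such inequality). -/
noncomputable def logSobolevConstant (μ : Measure ℝ) : ℝ≥0∞ :=
  ⨅ (C : ℝ≥0) (_ : SatisfiesLSI μ C), (C : ℝ≥0∞)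

/-- `V''(b⁺)`, for `V` of class `C²` on `[b, ∞)`. -/
noncomputable def rightSecondDeriv (V : ℝ → ℝ) (b : ℝ) : ℝ :=
  iteratedDerivWithin 2 V (Set.Ici b) b

/-- `V''(a⁻)`, for `V` of class `C²` on `(-∞, a]`. -/
noncomputable def leftSecondDeriv (V : ℝ → ℝ) (a : ℝ) : ℝ :=
  iteratedDerivWithin 2 V (Set.Iic a) a

/-! Put L = b - a and U = V - min V, and let δ be the mass of e^{-U/t} outside [a, b], so that Z = L
+ δ. Laplace's method gives δ ~ s√t with s = (√(2π/V''(a⁻)) + √(2π/V''(b⁺)))/2. The result amounts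
to C_LS(μ_t) = (L + δ)²/π² + o(√t): to this order the tails act like atoms at the endpoints, and an
interval with endpoint atoms is no worse than a longer interval of the same total mass. Expanding
the square leaves 2Lδ/π².

Upper bound. The core is the sharp inequality on an interval, `interval_lsi`. For g = log h², let p
be the logarithmic derivative of the Neumann ground state of -∂² - g/2, with eigenvalue l/2; thus p'
= -p² - (g + l)/2 and p = 0 at both ends (`exists_riccati`). Since (h' - ph)² ≥ 0, the energy of h
is at least half of ∫ h²(g + l). A lower bound on l remains, which amounts to: length ≤ ∫ exp(-2(p'
+ p²)). This is a calibration argument (`length_le_integral_exp_riccati`): an explicit function of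
(tan x, p), zero at p = 0, has derivative along the curve at most the integrand minus 1. Extending
functions by constants beyond [a, b] turns this into an inequality with atoms (`atoms_lsi`).
Replacing true tails by atoms costs O(t^{3/4}(1 - log t)) times the energy (`tail_entropy_le`), by a
weighted Hardy inequality with constant O(t) and the closeness of the normalised function to 1 on
[a, b]. `entropy_le` combines the two. The Polyak-Łojasiewicz inequality enters by making √U grow at
least linearly off [a, b].

Lower bound. A log-Sobolev inequality linearises to a Poincaré inequality with the same constant,
tested on the first nonconstant Neumann eigenfunction of [a, b], a sine. Near the endpoints it is
close to ±1 with vanishing derivative, so the tails add δ to the second moment and only o(√t) to the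
energy; its squared mean is O(δ²). -/

namespace LogSobolevLine

/-! ### Calibration inequality for slope curves -/

section Calibration
open Real Set

/-- A primitive of the Gaussian `exp (-2 r² / 3)`. -/
noncomputable def gaussPrim (x : ℝ) : ℝ := ∫ r in (0 : ℝ)..x, exp (-(2 / 3) * r ^ 2)

lemma hasDerivAt_gaussPrim (x : ℝ) : HasDerivAt gaussPrim (exp (-(2 / 3) * x ^ 2)) x := by
  have hc : Continuous fun r : ℝ => exp (-(2 / 3) * r ^ 2) := by fun_prop
  exact intervalIntegral.integral_hasDerivAt_right (hc.intervalIntegrable _ _)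
    (hc.stronglyMeasurableAtFilter _ _) hc.continuousAt

/-- The calibration potential. -/
noncomputable def calib (τ p : ℝ) : ℝ :=
  -2 * exp (3 / 2 * τ ^ 2) * (gaussPrim (p - 3 / 2 * τ) - gaussPrim (-(3 / 2 * τ)))

lemma calib_zero (τ : ℝ) : calib τ 0 = 0 := by simp [calib]

/-- Completing the square. The centre 3τ/2 and the prefactor in `calib` serve to give ∂_p `calib` =
-2 e^F with F = 2τp - 2p²/3. -/
lemma exp_mul_gauss (τ p : ℝ) :
    exp (3 / 2 * τ ^ 2) * exp (-(2 / 3) * (p - 3 / 2 * τ) ^ 2) =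
      exp (2 * τ * p - 2 / 3 * p ^ 2) := by
  rw [← exp_add]; congr 1; ring

/-- Derivative of the calibration potential along a curve `(τ, p)`. -/
lemma hasDerivWithinAt_calib {τ p : ℝ → ℝ} {τ' p' x : ℝ} {s : Set ℝ}
    (hτ : HasDerivWithinAt τ τ' s x) (hp : HasDerivWithinAt p p' s x) :
    HasDerivWithinAt (fun y => calib (τ y) (p y))
      (3 * τ x * τ' * calib (τ x) (p x) +
        3 * τ' * (exp (2 * τ x * p x - 2 / 3 * p x ^ 2) - 1) -
        2 * exp (2 * τ x * p x - 2 / 3 * p x ^ 2) * p') s x := by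
  have h1 := ((hτ.pow 2).const_mul (3 / 2)).exp.const_mul (-2)
  have h2 := (hasDerivAt_gaussPrim (p x - 3 / 2 * τ x)).comp_hasDerivWithinAt x
    (hp.sub (hτ.const_mul (3 / 2)))
  have h3 := (hasDerivAt_gaussPrim (-(3 / 2 * τ x))).comp_hasDerivWithinAt x
    (hτ.const_mul (3 / 2)).neg
  have h4 := h1.mul (h2.sub h3)
  refine h4.congr_deriv ?_
  have e1 := exp_mul_gauss (τ x) (p x)
  have e2 := exp_mul_gauss (τ x) 0
  rw [zero_sub] at e2
  have e3 : exp (2 * τ x * 0 - 2 / 3 * 0 ^ 2) = 1 := by simp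
  rw [e3] at e2
  simp only [calib, Pi.sub_apply, Function.comp_apply, Pi.pow_apply]
  linear_combination (-2 * p' + 3 * τ') * e1 - 3 * τ' * e2

/-- The defect of the Hamilton-Jacobi inequality satisfied by `calib`. -/
noncomputable def calibDefect (τ p : ℝ) : ℝ :=
  exp (2 * τ * p - 2 / 3 * p ^ 2) * (1 - 2 * p ^ 2 - (2 * τ * p - 2 / 3 * p ^ 2)) - 1 -
    (3 * τ * (1 + τ ^ 2) * calib τ p +
      3 * (1 + τ ^ 2) * (exp (2 * τ * p - 2 / 3 * p ^ 2) - 1))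

/-- With the coefficients 3/2 and 2/3 of `calib`, all lower powers of p cancel. What survives has
the sign of p, so p = 0 is the global minimum of the defect. -/
lemma hasDerivAt_calibDefect (τ p : ℝ) :
    HasDerivAt (calibDefect τ) (16 / 9 * p ^ 3 * exp (2 * τ * p - 2 / 3 * p ^ 2)) p := by
  have hE : HasDerivAt (fun p : ℝ => 2 * τ * p - 2 / 3 * p ^ 2) (2 * τ - 4 / 3 * p) p := by
    refine (((hasDerivAt_id p).const_mul (2 * τ)).sub
      (((hasDerivAt_id p).pow 2).const_mul (2 / 3))).congr_deriv ?_
    simp; ring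
  have hQ : HasDerivAt (fun p : ℝ => 1 - 2 * p ^ 2 - (2 * τ * p - 2 / 3 * p ^ 2))
      (-4 * p - (2 * τ - 4 / 3 * p)) p := by
    refine ((((hasDerivAt_id p).pow 2).const_mul 2).const_sub 1 |>.sub hE).congr_deriv ?_
    simp; ring
  have hC := hasDerivWithinAt_calib (hasDerivWithinAt_const p univ τ) (hasDerivWithinAt_id p univ)
  rw [hasDerivWithinAt_univ] at hC
  have := ((hE.exp.mul hQ).sub_const 1).sub
    ((hC.const_mul (3 * τ * (1 + τ ^ 2))).add
      ((hE.exp.sub_const 1).const_mul (3 * (1 + τ ^ 2))))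
  refine this.congr_deriv ?_
  simp only [id]
  ring

lemma calibDefect_nonneg (τ p : ℝ) : 0 ≤ calibDefect τ p := by
  have h0 : calibDefect τ 0 = 0 := by simp [calibDefect, calib_zero]
  have hd : Differentiable ℝ (calibDefect τ) :=
    fun p => (hasDerivAt_calibDefect τ p).differentiableAt
  rw [← h0]
  rcases le_total 0 p with hp | hp
  · refine monotoneOn_of_deriv_nonneg (convex_Ici 0) hd.continuous.continuousOn
      hd.differentiableOn (fun x hx => ?_) self_mem_Ici hp hp
    rw [interior_Ici, mem_Ioi] at hx
    rw [(hasDerivAt_calibDefect τ x).deriv]; positivity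
  · refine antitoneOn_of_deriv_nonpos (convex_Iic 0) hd.continuous.continuousOn
      hd.differentiableOn (fun x hx => ?_) hp self_mem_Iic hp
    rw [interior_Iic, mem_Iio] at hx
    rw [(hasDerivAt_calibDefect τ x).deriv]
    have : x ^ 3 < 0 := Odd.pow_neg (by decide) hx
    exact mul_nonpos_of_nonpos_of_nonneg (by linarith) (exp_pos _).le

/-- Convexity: the tangent line of exp at F = 2τp - 2p²/3 has slope -2e^F in v, the same as the left
side. The difference no longer involves v and is exactly `calibDefect`, for τ' = 1 + τ². -/
lemma one_add_calib_deriv_le (τ p v : ℝ) :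
    1 + (3 * τ * (1 + τ ^ 2) * calib τ p +
        3 * (1 + τ ^ 2) * (exp (2 * τ * p - 2 / 3 * p ^ 2) - 1) -
        2 * exp (2 * τ * p - 2 / 3 * p ^ 2) * v) ≤ exp (-2 * (v + p ^ 2)) := by
  have h := calibDefect_nonneg τ p
  have hF : exp (2 * τ * p - 2 / 3 * p ^ 2) *
      (1 + (-2 * (v + p ^ 2) - (2 * τ * p - 2 / 3 * p ^ 2))) ≤ exp (-2 * (v + p ^ 2)) := by
    have h1 := add_one_le_exp (-2 * (v + p ^ 2) - (2 * τ * p - 2 / 3 * p ^ 2))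
    have h2 := mul_le_mul_of_nonneg_left h1 (exp_pos (2 * τ * p - 2 / 3 * p ^ 2)).le
    rw [← exp_add] at h2
    calc _ = _ := by ring
      _ ≤ _ := h2
      _ = _ := by congr 1; ring
  unfold calibDefect at h
  linarith

/-- A curve of slope functions vanishing at both ends of an interval of length less than `π`. -/
lemma length_le_integral_exp_riccati {α β : ℝ} (hα : -(π / 2) < α) (hαβ : α ≤ β) (hβ : β < π / 2)
    {p p' : ℝ → ℝ} (hp : ∀ x ∈ Icc α β, HasDerivWithinAt p (p' x) (Icc α β) x)
    (hp' : ContinuousOn p' (Icc α β)) (h0 : p α = 0) (h1 : p β = 0) :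
    β - α ≤ ∫ x in α..β, exp (-2 * (p' x + p x ^ 2)) := by
  have hpc : ContinuousOn p (Icc α β) := fun x hx => (hp x hx).continuousWithinAt
  -- The calibration needs a solution of τ' = 1 + τ² on the whole interval; the lifetime of tan is
  -- where π enters the sharp constant.
  have hτ : ∀ x ∈ Icc α β, HasDerivAt tan (1 + tan x ^ 2) x := fun x hx => by
    have hc : 0 < cos x := cos_pos_of_mem_Ioo ⟨by linarith [hx.1], by linarith [hx.2]⟩
    refine (hasDerivAt_tan hc.ne').congr_deriv ?_
    rw [tan_eq_sin_div_cos]; field_simp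
    linarith [sin_sq_add_cos_sq x]
  have hd : ∀ x ∈ Icc α β, HasDerivWithinAt (fun y => y + calib (tan y) (p y))
      (1 + (3 * tan x * (1 + tan x ^ 2) * calib (tan x) (p x) +
        3 * (1 + tan x ^ 2) * (exp (2 * tan x * p x - 2 / 3 * p x ^ 2) - 1) -
        2 * exp (2 * tan x * p x - 2 / 3 * p x ^ 2) * p' x)) (Icc α β) x := fun x hx =>
    (hasDerivWithinAt_id x _).add (hasDerivWithinAt_calib (hτ x hx).hasDerivWithinAt (hp x hx))
  have := intervalIntegral.sub_le_integral_of_hasDeriv_right_of_le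
    (φ := fun x => exp (-2 * (p' x + p x ^ 2))) hαβ
    (fun x hx => (hd x hx).continuousWithinAt)
    (fun x hx => ((hd x ⟨hx.1.le, hx.2.le⟩).hasDerivAt
      (Icc_mem_nhds hx.1 hx.2)).hasDerivWithinAt)
    (ContinuousOn.integrableOn_Icc (by fun_prop))
    (fun x _ => one_add_calib_deriv_le _ _ _)
  simpa [h0, h1, calib_zero] using this

end Calibration

/-! ### Neumann ground state by shooting -/

section Riccati
open Real Set

lemma abs_clip_le {R : ℝ} (hR : 0 ≤ R) (q : ℝ) : |max (-R) (min R q)| ≤ R :=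
  abs_le.2 ⟨le_max_left _ _, max_le (by linarith) (min_le_left _ _)⟩

lemma abs_clip_sub_clip_le (R q r : ℝ) :
    |max (-R) (min R q) - max (-R) (min R r)| ≤ |q - r| := by
  refine (abs_max_sub_max_le_max _ _ _ _).trans ?_
  refine max_le (by simp) ((abs_min_sub_min_le_max _ _ _ _).trans (max_le (by simp) le_rfl))

/-- Riccati vector field with truncated quadratic part. -/
noncomputable def truncRiccati (R : ℝ) (g : ℝ → ℝ) (l x q : ℝ) : ℝ :=
  -(max (-R) (min R q)) ^ 2 - (g x + l) / 2

lemma lipschitzWith_truncRiccati {R : ℝ} (hR : 0 ≤ R) (g : ℝ → ℝ) (l x : ℝ) :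
    LipschitzWith (Real.toNNReal (2 * R)) (truncRiccati R g l x) := by
  refine LipschitzWith.of_dist_le_mul fun q r => ?_
  rw [Real.coe_toNNReal _ (by positivity), Real.dist_eq, Real.dist_eq]
  unfold truncRiccati
  set c := max (-R) (min R q)
  set d := max (-R) (min R r)
  have h1 : |c - d| ≤ |q - r| := abs_clip_sub_clip_le R q r
  have h2 : |c + d| ≤ 2 * R :=
    (abs_add_le c d).trans (by linarith [abs_clip_le hR q, abs_clip_le hR r])
  calc |-c ^ 2 - (g x + l) / 2 - (-d ^ 2 - (g x + l) / 2)| = |c + d| * |c - d| := by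
        rw [← abs_mul, ← abs_neg]; congr 1; ring
    _ ≤ 2 * R * |q - r| := by gcongr

lemma exists_truncRiccati_solution {R S α β : ℝ} (hR : 0 ≤ R) (hαβ : α ≤ β) {g : ℝ → ℝ}
    (hg : Continuous g) (hS : ∀ x ∈ Icc α β, |g x| ≤ S) {l : ℝ} (hl : |l| ≤ S) :
    ∃ q : ℝ → ℝ, q α = 0 ∧
      ∀ x ∈ Icc α β, HasDerivWithinAt q (truncRiccati R g l x (q x)) (Icc α β) x := by
  have hS0 : 0 ≤ S := (abs_nonneg _).trans hl
  have hB : 0 ≤ R ^ 2 + S := by positivity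
  -- The truncated field is bounded by R² + S, so a ball of radius (R² + S)(β - α) contains the
  -- solution up to time β.
  have h : IsPicardLindelof (truncRiccati R g l) (⟨α, left_mem_Icc.2 hαβ⟩ : Icc α β) (0 : ℝ)
      (Real.toNNReal ((R ^ 2 + S) * (β - α))) 0 (Real.toNNReal (R ^ 2 + S))
      (Real.toNNReal (2 * R)) := by
    refine ⟨fun x _ => (lipschitzWith_truncRiccati hR g l x).lipschitzOnWith, fun q _ => ?_,
      fun x hx q _ => ?_, ?_⟩
    · unfold truncRiccati; fun_prop
    · rw [Real.coe_toNNReal _ hB, Real.norm_eq_abs, truncRiccati]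
      have h1 : (max (-R) (min R q)) ^ 2 ≤ R ^ 2 :=
        sq_le_sq' (le_max_left _ _) (max_le (by linarith) (min_le_left _ _))
      have h2 := abs_le.1 (hS x hx)
      have h3 := abs_le.1 hl
      rw [abs_le]
      constructor
      · linarith [h2.2, h3.2]
      · nlinarith [h2.1, h3.1, sq_nonneg (max (-R) (min R q))]
    · rw [Real.coe_toNNReal _ hB, Real.coe_toNNReal _ (mul_nonneg hB (by linarith))]
      simp [sub_nonneg.2 hαβ]
  exact h.exists_eq_forall_mem_Icc_hasDerivWithinAt₀

/-- The Neumann ground state of a Schrödinger operator, in Riccati form. -/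
lemma exists_riccati {α β : ℝ} (hαβ : α < β) {g : ℝ → ℝ} (hg : Continuous g) :
    ∃ l : ℝ, ∃ p : ℝ → ℝ, p α = 0 ∧ p β = 0 ∧
      ∀ x ∈ Icc α β, HasDerivWithinAt p (-(p x) ^ 2 - (g x + l) / 2) (Icc α β) x := by
  obtain ⟨S, hS⟩ := (isCompact_Icc (a := α) (b := β)).exists_bound_of_continuousOn
    hg.continuousOn
  simp only [Real.norm_eq_abs] at hS
  have hS0 : 0 ≤ S := (abs_nonneg _).trans (hS α (left_mem_Icc.2 hαβ.le))
  -- A solution with q(α) = q(β) = 0 and |l| ≤ S satisfies |q| ≤ R, so truncation at this level will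
  -- be inactive for the solution selected by shooting.
  set R := S * (β - α) with hRdef
  have hR : 0 ≤ R := mul_nonneg hS0 (by linarith)
  choose! q hq0 hq using fun (l : ℝ) (hl : |l| ≤ S) =>
    exists_truncRiccati_solution hR hαβ.le hg hS hl
  have hmemS : ∀ l ∈ Icc (-S) S, |l| ≤ S := fun l hl => abs_le.2 hl
  have hqc : ∀ l, |l| ≤ S → ContinuousOn (q l) (Icc α β) :=
    fun l hl x hx => (hq l hl x hx).continuousWithinAt
  have hqI : ∀ l, |l| ≤ S → ∀ x ∈ Ico α β,
      HasDerivWithinAt (q l) (truncRiccati R g l x (q l x)) (Ici x) x := fun l hl x hx =>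
    (hq l hl x ⟨hx.1, hx.2.le⟩).mono_of_mem_nhdsWithin (Icc_mem_nhdsGE_of_mem hx)
  have hqA : ∀ l, |l| ≤ S → ∀ x ∈ Ioo α β,
      HasDerivAt (q l) (truncRiccati R g l x (q l x)) x := fun l hl x hx =>
    (hq l hl x ⟨hx.1.le, hx.2.le⟩).hasDerivAt (Icc_mem_nhds hx.1 hx.2)
  -- Shooting in l: the end value is continuous by Grönwall, nonpositive for l = S and nonnegative
  -- for l = -S.
  have hcont : ContinuousOn (fun l => q l β) (Icc (-S) S) := by
    have key : ∀ l ∈ Icc (-S) S, ∀ m ∈ Icc (-S) S, dist (q l β) (q m β) ≤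
        gronwallBound 0 (Real.toNNReal (2 * R)) (0 + |l - m| / 2) (β - α) := by
      intro l hl m hm
      refine dist_le_of_approx_trajectories_ODE
        (v := truncRiccati R g m) (fun x => lipschitzWith_truncRiccati hR g m x)
        (hqc m (hmemS m hm)) (hqI m (hmemS m hm)) (fun x _ => (dist_self _).le)
        (hqc l (hmemS l hl)) (hqI l (hmemS l hl)) (εg := |l - m| / 2) (fun x _ => ?_) ?_
        β (right_mem_Icc.2 hαβ.le) |> fun h => (dist_comm _ _).trans_le h
      · rw [Real.dist_eq, truncRiccati, truncRiccati, ← abs_neg]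
        apply le_of_eq
        rw [show |l - m| / 2 = |(l - m) / 2| by rw [abs_div, abs_two]]
        congr 1; ring
      · rw [hq0 l (hmemS l hl), hq0 m (hmemS m hm), dist_self]
    intro l hl
    rw [ContinuousWithinAt, tendsto_iff_dist_tendsto_zero]
    have ht : Tendsto (fun m => gronwallBound 0 (Real.toNNReal (2 * R)) (0 + |m - l| / 2) (β - α))
        (𝓝[Icc (-S) S] l) (𝓝 0) := by
      have h1 : Continuous fun m =>
          gronwallBound 0 (Real.toNNReal (2 * R)) (0 + |m - l| / 2) (β - α) :=
        (gronwallBound_continuous_ε _ _ _).comp (by fun_prop)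
      have h2 := h1.tendsto l
      simp only [sub_self, abs_zero, zero_div, add_zero, gronwallBound_ε0_δ0] at h2
      exact h2.mono_left nhdsWithin_le_nhds
    refine squeeze_zero' (Eventually.of_forall fun _ => dist_nonneg) ?_ ht
    filter_upwards [self_mem_nhdsWithin] with m hm using key m hm l hl
  have hmS : |-S| ≤ S := by rw [abs_neg, abs_of_nonneg hS0]
  have hpS : |S| ≤ S := by rw [abs_of_nonneg hS0]
  have hend : q S β ≤ 0 := by
    have : AntitoneOn (q S) (Icc α β) := by
      refine antitoneOn_of_deriv_nonpos (convex_Icc _ _) (hqc S hpS) ?_ ?_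
      · rw [interior_Icc]
        exact fun x hx => (hqA S hpS x hx).differentiableAt.differentiableWithinAt
      · rw [interior_Icc]
        intro x hx
        rw [(hqA S hpS x hx).deriv, truncRiccati]
        have := abs_le.1 (hS x ⟨hx.1.le, hx.2.le⟩)
        nlinarith [sq_nonneg (max (-R) (min R (q S x))), this.1]
    have h := this (left_mem_Icc.2 hαβ.le) (right_mem_Icc.2 hαβ.le) hαβ.le
    rwa [hq0 S hpS] at h
  -- For l = -S the source term (S - g)/2 is nonnegative. After the last point x0 with q ≥ 0, the
  -- clipped square is at most -Rq, so e^{-Rx} q is nondecreasing and cannot become negative.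
  have hstart : 0 ≤ q (-S) β := by
    by_contra! hneg
    have hc : ContinuousOn (q (-S)) (Icc α β) := hqc _ hmS
    have hclosed : IsCompact (Icc α β ∩ q (-S) ⁻¹' Ici 0) :=
      isCompact_Icc.of_isClosed_subset (hc.preimage_isClosed_of_isClosed isClosed_Icc isClosed_Ici)
        inter_subset_left
    obtain ⟨x0, hx0, hmax⟩ := hclosed.exists_isGreatest
      ⟨α, left_mem_Icc.2 hαβ.le, by simp [hq0 _ hmS]⟩
    have hx0β : x0 < β := lt_of_le_of_ne hx0.1.2 fun h => by
      have := hx0.2; rw [h] at this; exact absurd hneg (not_lt.2 this)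
    have hnegI : ∀ x ∈ Ioo x0 β, q (-S) x < 0 := fun x hx => by
      by_contra! h
      exact absurd (hmax ⟨⟨hx0.1.1.trans hx.1.le, hx.2.le⟩, h⟩) (not_le.2 hx.1)
    have hmono : MonotoneOn (fun x => exp (-R * x) * q (-S) x) (Icc x0 β) := by
      have hsub : Icc x0 β ⊆ Icc α β := Icc_subset_Icc_left hx0.1.1
      refine monotoneOn_of_deriv_nonneg (convex_Icc _ _)
        (ContinuousOn.mul (by fun_prop) (hc.mono hsub)) ?_ ?_
      all_goals
        rw [interior_Icc]
        intro x hx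
        have hd : HasDerivAt (fun x => exp (-R * x) * q (-S) x) _ x :=
          (((hasDerivAt_id x).const_mul (-R)).exp).mul (hqA _ hmS x ⟨hx0.1.1.trans_lt hx.1, hx.2⟩)
      · exact hd.differentiableAt.differentiableWithinAt
      · rw [hd.deriv, truncRiccati]
        have hqn := hnegI x hx
        have h2 := abs_le.1 (hS x ⟨hx0.1.1.trans hx.1.le, hx.2.le⟩)
        have hmin : min R (q (-S) x) = q (-S) x := min_eq_right (by linarith)
        rw [hmin]
        set c := max (-R) (q (-S) x)
        have hc1 : -R ≤ c := le_max_left _ _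
        have hc2 : q (-S) x ≤ c := le_max_right _ _
        have hc3 : c ≤ 0 := max_le (by linarith) hqn.le
        have hsq : c ^ 2 ≤ -R * q (-S) x := by nlinarith
        have he := exp_pos (-R * x)
        simp only [id, mul_one]
        nlinarith [h2.2, mul_nonneg he.le (sub_nonneg.2 hsq),
          mul_nonneg he.le (by linarith [h2.2] : 0 ≤ S - g x)]
    have h := hmono (left_mem_Icc.2 hx0β.le) (right_mem_Icc.2 hx0β.le) hx0β.le
    have h1 : 0 ≤ exp (-R * x0) * q (-S) x0 := mul_nonneg (exp_pos _).le hx0.2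
    have h2 : exp (-R * β) * q (-S) β < 0 := mul_neg_of_pos_of_neg (exp_pos _) hneg
    simp only at h
    linarith
  obtain ⟨l, hl, hlβ⟩ : ∃ l ∈ Icc (-S) S, q l β = 0 :=
    intermediate_value_Icc' (by linarith) hcont ⟨hend, hstart⟩
  have hlS := hmemS l hl
  -- The one-sided bound q' ≤ S, used from both ends where q = 0, gives -S(β - x) ≤ q ≤ S(x - α),
  -- hence |q| ≤ R.
  have hanti : AntitoneOn (fun x => q l x - S * x) (Icc α β) := by
    refine antitoneOn_of_deriv_nonpos (convex_Icc _ _)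
      ((hqc l hlS).sub (by fun_prop)) ?_ ?_
    all_goals
      rw [interior_Icc]
      intro x hx
      have hd : HasDerivAt (fun x => q l x - S * x) _ x :=
        (hqA l hlS x hx).sub ((hasDerivAt_id x).const_mul S)
    · exact hd.differentiableAt.differentiableWithinAt
    · rw [hd.deriv, truncRiccati]
      have h2 := abs_le.1 (hS x ⟨hx.1.le, hx.2.le⟩)
      nlinarith [sq_nonneg (max (-R) (min R (q l x))), h2.1, hl.1]
  refine ⟨l, q l, hq0 l hlS, hlβ, fun x hx => ?_⟩
  have h1 := hanti (left_mem_Icc.2 hαβ.le) hx hx.1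
  have h2 := hanti hx (right_mem_Icc.2 hαβ.le) hx.2
  simp only [hq0 l hlS, hlβ] at h1 h2
  have hu : q l x ≤ R := by
    nlinarith [mul_le_mul_of_nonneg_left hx.2 hS0]
  have hlo : -R ≤ q l x := by
    nlinarith [mul_le_mul_of_nonneg_left hx.1 hS0]
  have h := hq l hlS x hx
  rwa [truncRiccati, min_eq_right hu, max_eq_right hlo] at h

end Riccati

/-! ### Sharp log-Sobolev inequality on an interval -/

section IntervalLSI
open Real Set

/-- Sharp logarithmic Sobolev inequality on an interval of length less than `π`. -/
lemma interval_lsi_unit {α β : ℝ} (hα : -(π / 2) < α) (hαβ : α < β) (hβ : β < π / 2)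
    {h h' : ℝ → ℝ} (hc : Continuous h) (hpos : ∀ x, 0 < h x)
    (hd : ∀ x ∈ Ioo α β, HasDerivWithinAt h (h' x) (Ioi x) x)
    (hi : IntegrableOn (fun x => h' x ^ 2) (Icc α β)) :
    (∫ x in α..β, h x ^ 2 * log (h x ^ 2)) -
        (∫ x in α..β, h x ^ 2) * log ((∫ x in α..β, h x ^ 2) / (β - α)) ≤
      2 * ∫ x in α..β, h' x ^ 2 := by
  have hsq : Continuous fun x => h x ^ 2 := hc.pow 2
  have hg : Continuous fun x => log (h x ^ 2) :=
    hsq.log fun x => (pow_pos (hpos x) 2).ne'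
  obtain ⟨l, p, hp0, hp1, hp⟩ := exists_riccati hαβ hg
  have hpc : ContinuousOn p (Icc α β) := fun x hx => (hp x hx).continuousWithinAt
  have hcal := length_le_integral_exp_riccati hα hαβ.le hβ hp
    (((hpc.pow 2).neg).sub ((hg.continuousOn.add continuousOn_const).div_const 2)) hp0 hp1
  have hM : ∫ x in α..β, exp (-2 * (-(p x) ^ 2 - (log (h x ^ 2) + l) / 2 + p x ^ 2)) =
      exp l * ∫ x in α..β, h x ^ 2 := by
    rw [← intervalIntegral.integral_const_mul]
    refine intervalIntegral.integral_congr fun x _ => ?_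
    rw [show -2 * (-(p x) ^ 2 - (log (h x ^ 2) + l) / 2 + p x ^ 2) = l + log (h x ^ 2) by ring,
      exp_add, exp_log (pow_pos (hpos x) 2)]
  rw [hM] at hcal
  set M := ∫ x in α..β, h x ^ 2 with hMdef
  have hMpos : 0 < M := intervalIntegral.intervalIntegral_pos_of_pos
    (hsq.intervalIntegrable _ _) (fun x => pow_pos (hpos x) 2) hαβ
  -- The Riccati equation gives exp(-2(p' + p²)) = e^l h², so the calibration inequality reads β - α
  -- ≤ e^l M.
  have hl : -log (M / (β - α)) ≤ l := by
    have hba : 0 < β - α := sub_pos.2 hαβ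
    have h1 : 1 ≤ exp l * (M / (β - α)) := by
      rw [← mul_div_assoc, one_le_div hba]; exact hcal
    have h2 := log_le_log one_pos h1
    rw [log_one, log_mul (exp_pos l).ne' (by positivity), log_exp] at h2
    linarith
  have hent : Continuous fun x => h x ^ 2 * log (h x ^ 2) := hsq.mul hg
  -- Ground state representation: the pointwise inequality between g' and φ is (h' - ph)² ≥ 0, and p
  -- h² vanishes at both ends.
  have hparts := intervalIntegral.sub_le_integral_of_hasDeriv_right_of_le
    (g := fun x => p x * h x ^ 2)
    (g' := fun x => (-(p x) ^ 2 - (log (h x ^ 2) + l) / 2) * h x ^ 2 + p x * (2 * h x * h' x))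
    (φ := fun x => -(1 / 2) * (h x ^ 2 * log (h x ^ 2)) - l / 2 * h x ^ 2 + h' x ^ 2) hαβ.le
    (hpc.mul hsq.continuousOn)
    (fun x hx => by
      have h1 : HasDerivWithinAt p _ (Ioi x) x := ((hp x ⟨hx.1.le, hx.2.le⟩).hasDerivAt
        (Icc_mem_nhds hx.1 hx.2)).hasDerivWithinAt
      refine (h1.mul ((hd x hx).pow 2)).congr_deriv ?_
      simp)
    (IntegrableOn.add (f := fun x => -(1 / 2) * (h x ^ 2 * log (h x ^ 2)) - l / 2 * h x ^ 2)
      (by fun_prop : Continuous _).continuousOn.integrableOn_Icc hi)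
    (fun x _ => by nlinarith [sq_nonneg (h' x - p x * h x)])
  have hii : IntervalIntegrable (fun x => h' x ^ 2) volume α β :=
    (intervalIntegrable_iff_integrableOn_Icc_of_le hαβ.le).2 hi
  rw [intervalIntegral.integral_add
      (((hent.intervalIntegrable _ _).const_mul _).sub
        ((hsq.intervalIntegrable _ _).const_mul _)) hii,
    intervalIntegral.integral_sub ((hent.intervalIntegrable _ _).const_mul _)
        ((hsq.intervalIntegrable _ _).const_mul _),
    intervalIntegral.integral_const_mul, intervalIntegral.integral_const_mul, ← hMdef] at hparts
  simp only [hp0, hp1, zero_mul, sub_zero] at hparts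
  nlinarith [mul_le_mul_of_nonneg_right hl hMpos.le]

/-- Sharp logarithmic Sobolev inequality on a bounded interval. -/
theorem interval_lsi {A B : ℝ} (hAB : A < B) {h h' : ℝ → ℝ} (hc : Continuous h)
    (hpos : ∀ x, 0 < h x) (hd : ∀ x ∈ Ioo A B, HasDerivWithinAt h (h' x) (Ioi x) x)
    (hi : IntegrableOn (fun x => h' x ^ 2) (Icc A B)) :
    (∫ x in A..B, h x ^ 2 * log (h x ^ 2)) -
        (∫ x in A..B, h x ^ 2) * log ((∫ x in A..B, h x ^ 2) / (B - A)) ≤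
      2 * (B - A) ^ 2 / π ^ 2 * ∫ x in A..B, h' x ^ 2 := by
  have hL : 0 < B - A := sub_pos.2 hAB
  -- Scaling by s makes the length strictly less than π, as the calibration requires; the sharp
  -- constant comes from letting s decrease to (B - A)/π.
  have key : ∀ s : ℝ, (B - A) / π < s →
      (∫ x in A..B, h x ^ 2 * log (h x ^ 2)) -
        (∫ x in A..B, h x ^ 2) * log ((∫ x in A..B, h x ^ 2) / (B - A)) ≤
      2 * s ^ 2 * ∫ x in A..B, h' x ^ 2 := by
    intro s hs
    have hs0 : 0 < s := (div_pos hL pi_pos).trans hs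
    rw [div_lt_iff₀ pi_pos] at hs
    set m := (A + B) / 2 with hm
    have hA : s * ((A - m) / s) + m = A := by field_simp; ring
    have hB : s * ((B - m) / s) + m = B := by field_simp; ring
    have hsub : ∀ F : ℝ → ℝ, ∫ y in ((A - m) / s)..((B - m) / s), F (s * y + m) =
        s⁻¹ * ∫ x in A..B, F x := by
      intro F
      rw [intervalIntegral.integral_comp_mul_add F hs0.ne' m, hA, hB, smul_eq_mul]
    have hαβ : (A - m) / s < (B - m) / s := by gcongr
    have h1 := interval_lsi_unit (α := (A - m) / s) (β := (B - m) / s)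
      (h := fun y => h (s * y + m)) (h' := fun y => s * h' (s * y + m))
      (by rw [lt_div_iff₀ hs0]; linarith) hαβ (by rw [div_lt_iff₀ hs0]; linarith)
      (hc.comp (by fun_prop)) (fun y => hpos _)
      (fun y hy => by
        have hy1 : A < s * y + m := by
          have := hy.1; rw [div_lt_iff₀ hs0] at this; linarith
        have hy2 : s * y + m < B := by
          have := hy.2; rw [lt_div_iff₀ hs0] at this; linarith
        have hlin : HasDerivWithinAt (fun y => s * y + m) (s * 1) (Ioi y) y :=
          (((hasDerivAt_id y).const_mul s).add_const m).hasDerivWithinAt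
        refine ((hd (s * y + m) ⟨hy1, hy2⟩).comp y hlin fun z (hz : y < z) => ?_).congr_deriv
          (by ring)
        simp only [mem_Ioi]; gcongr)
      (by
        have h2 : IntervalIntegrable (fun x => h' x ^ 2) volume A B :=
          (intervalIntegrable_iff_integrableOn_Icc_of_le hAB.le).2 hi
        rw [← intervalIntegrable_iff_integrableOn_Icc_of_le hαβ.le]
        have h3 := ((h2.comp_add_right m).comp_mul_left (c := s)).const_mul (s ^ 2)
        simp only [mul_pow]
        exact h3)
    have e1 := hsub fun x => h x ^ 2 * log (h x ^ 2)
    have e2 := hsub fun x => h x ^ 2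
    have e3 := hsub fun x => (s * h' x) ^ 2
    rw [e1, e2, e3] at h1
    simp only [mul_pow, intervalIntegral.integral_const_mul] at h1
    have e4 : s⁻¹ * (∫ x in A..B, h x ^ 2) / ((B - m) / s - (A - m) / s) =
        (∫ x in A..B, h x ^ 2) / (B - A) := by
      rw [show (B - m) / s - (A - m) / s = s⁻¹ * (B - A) by ring,
        mul_div_mul_left _ _ (inv_pos.2 hs0).ne']
    rw [e4] at h1
    have h5 := mul_le_mul_of_nonneg_left h1 hs0.le
    calc _ = s * (s⁻¹ * (∫ x in A..B, h x ^ 2 * log (h x ^ 2)) -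
          s⁻¹ * (∫ x in A..B, h x ^ 2) * log ((∫ x in A..B, h x ^ 2) / (B - A))) := by
          field_simp
      _ ≤ _ := h5
      _ = _ := by field_simp
  have hlim : Tendsto (fun s : ℝ => 2 * s ^ 2 * ∫ x in A..B, h' x ^ 2) (𝓝[>] ((B - A) / π))
      (𝓝 (2 * ((B - A) / π) ^ 2 * ∫ x in A..B, h' x ^ 2)) :=
    ((by fun_prop : Continuous fun s : ℝ => 2 * s ^ 2 * ∫ x in A..B, h' x ^ 2).tendsto _).mono_left
      nhdsWithin_le_nhds
  have := ge_of_tendsto hlim (eventually_nhdsWithin_of_forall key)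
  rwa [div_pow, mul_div_assoc'] at this

end IntervalLSI

/-! ### Entropy and Hardy estimates on a tail -/

section Tail
open Real Set

/-- The integrand `h² log h² - h²` of the variational formula for the entropy. -/
noncomputable def psi (h : ℝ) : ℝ := h ^ 2 * log (h ^ 2) - h ^ 2

lemma continuous_psi : Continuous psi :=
  (continuous_mul_log.comp (continuous_pow 2)).sub (continuous_pow 2)

/-- A second-order Taylor bound: `psi` has derivative 4k log k and a second derivative of only
logarithmic size. The cases are the signs of k² + 2ku, the factor that multiplies log(k + u) - log k
after expansion. -/
lemma psi_add_sub_le {k u : ℝ} (hk : 0 < k) (hku : 0 < k + u) :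
    psi (k + u) - psi k ≤ 4 * (k * log k) * u + u ^ 2 * (3 + 2 * log (1 + k + 2 * |u|)) := by
  have e1 : log ((k + u) ^ 2) = 2 * log (k + u) := by rw [log_pow]; norm_num
  have e2 : log (k ^ 2) = 2 * log k := by rw [log_pow]; norm_num
  have hmono : ∀ z, 0 < z → z ≤ 1 + k + 2 * |u| → log z ≤ log (1 + k + 2 * |u|) :=
    fun z hz h => log_le_log hz h
  set Λ := log (1 + k + 2 * |u|)
  rw [psi, psi, e1, e2]
  rcases le_total 0 (k ^ 2 + 2 * k * u) with h | h
  · have h1 : log (k + u) - log k ≤ u / k := by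
      rw [← log_div hku.ne' hk.ne']
      refine (log_le_sub_one_of_pos (by positivity)).trans_eq ?_
      field_simp; ring
    have h2 := mul_le_mul_of_nonneg_left h1 h
    have h3 : (k ^ 2 + 2 * k * u) * (u / k) = k * u + 2 * u ^ 2 := by field_simp
    have h4 : log (k + u) ≤ Λ :=
      hmono _ hku (by linarith [le_abs_self u, abs_nonneg u])
    nlinarith [mul_le_mul_of_nonneg_left h4 (sq_nonneg u)]
  · have hu : k + 2 * u ≤ 0 := by
      by_contra! h'
      nlinarith
    have h1 : log (k + u) ≤ log k := log_le_log hku (by linarith)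
    have h4 : log k ≤ Λ := hmono _ hk (by linarith [abs_nonneg u])
    nlinarith [mul_le_mul_of_nonneg_left h4 (sq_nonneg u),
      mul_le_mul_of_nonneg_left h1 (sq_nonneg (k + u))]

/-- Makes the linear term of `psi_add_sub_le` small when k is close to 1. -/
lemma abs_mul_log_le {k : ℝ} (hk : 0 < k) : |k * log k| ≤ |k - 1| * (1 + log (1 + k)) := by
  have hl : 0 ≤ log (1 + k) := log_nonneg (by linarith)
  rcases le_total 1 k with h | h
  · have h0 := log_nonneg h
    have h1 := log_le_sub_one_of_pos hk
    have h2 : log k ≤ log (1 + k) := log_le_log hk (by linarith)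
    rw [abs_of_nonneg (by positivity), abs_of_nonneg (by linarith)]
    nlinarith [mul_le_mul_of_nonneg_left h2 (by linarith : 0 ≤ k - 1)]
  · have h0 := log_nonpos hk.le h
    have h1 := one_sub_inv_le_log_of_pos hk
    have h2 := mul_le_mul_of_nonneg_left h1 hk.le
    rw [mul_sub, mul_inv_cancel₀ hk.ne'] at h2
    rw [abs_of_nonpos (mul_nonpos_of_nonneg_of_nonpos hk.le h0), abs_of_nonpos (by linarith)]
    nlinarith [mul_nonneg (by linarith : 0 ≤ 1 - k) hl]

/-- A potential on the half-line `[b, ∞)` vanishing at `b`, whose square root grows at least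
linearly. -/
structure TailPotential (U : ℝ → ℝ) (b κ : ℝ) : Prop where
  diff : Differentiable ℝ U
  zero : U b = 0
  slope_pos : 0 < κ
  pos : ∀ x, b < x → 0 < U x
  slope : ∀ x, b < x → 2 * κ * √(U x) ≤ deriv U x

namespace TailPotential

variable {U : ℝ → ℝ} {b κ : ℝ}

lemma nonneg (hU : TailPotential U b κ) {x : ℝ} (hx : b ≤ x) : 0 ≤ U x := by
  rcases hx.eq_or_lt with rfl | h
  · exact hU.zero.ge
  · exact (hU.pos x h).le

lemma monotoneOn (hU : TailPotential U b κ) : MonotoneOn U (Ici b) := by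
  refine monotoneOn_of_deriv_nonneg (convex_Ici _) hU.diff.continuous.continuousOn
    hU.diff.differentiableOn fun x hx => ?_
  rw [interior_Ici, mem_Ioi] at hx
  have := hU.slope_pos
  exact le_trans (by positivity) (hU.slope x hx)

lemma hasDerivAt_sqrt (hU : TailPotential U b κ) {x : ℝ} (hx : b < x) :
    HasDerivAt (fun x => √(U x)) (deriv U x / (2 * √(U x))) x :=
  (hU.diff x).hasDerivAt.sqrt (hU.pos x hx).ne'

lemma le_deriv_sqrt (hU : TailPotential U b κ) {x : ℝ} (hx : b < x) :
    κ ≤ deriv U x / (2 * √(U x)) := by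
  have h := sqrt_pos.2 (hU.pos x hx)
  rw [le_div_iff₀ (by positivity)]
  linarith [hU.slope x hx]

lemma mul_sub_le_sqrt (hU : TailPotential U b κ) {x : ℝ} (hx : b ≤ x) :
    κ * (x - b) ≤ √(U x) := by
  have hc : Continuous fun x => √(U x) := hU.diff.continuous.sqrt
  have hd : ∀ x, b < x → HasDerivAt (fun x => √(U x) - κ * x)
      (deriv U x / (2 * √(U x)) - κ * 1) x := fun x hx =>
    (hU.hasDerivAt_sqrt hx).sub ((hasDerivAt_id x).const_mul κ)
  have hm : MonotoneOn (fun x => √(U x) - κ * x) (Ici b) := by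
    refine monotoneOn_of_deriv_nonneg (convex_Ici _) (by fun_prop) ?_ ?_
    all_goals
      rw [interior_Ici]
      intro x hx
    · exact (hd x hx).differentiableAt.differentiableWithinAt
    · rw [(hd x hx).deriv]; linarith [hU.le_deriv_sqrt hx]
  have := hm self_mem_Ici hx hx
  simp only [hU.zero, sqrt_zero] at this
  linarith

lemma sq_le (hU : TailPotential U b κ) {x : ℝ} (hx : b ≤ x) : κ ^ 2 * (x - b) ^ 2 ≤ U x := by
  have h := hU.mul_sub_le_sqrt hx
  have h0 : 0 ≤ κ * (x - b) := mul_nonneg hU.slope_pos.le (by linarith)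
  calc _ = (κ * (x - b)) ^ 2 := by ring
    _ ≤ √(U x) ^ 2 := by gcongr
    _ = U x := sq_sqrt (hU.nonneg hx)

/-- Weighted Hardy inequality on the tail. -/
lemma hardy (hU : TailPotential U b κ) {t X : ℝ} (ht : 0 < t) (hX : b ≤ X) {u u' : ℝ → ℝ}
    (hu : ∀ x, HasDerivAt u (u' x) x) (hu' : Continuous u') (hub : u b = 0) :
    ∫ x in b..X, u x ^ 2 * (1 + U x / t) * exp (-U x / t) ≤
      128 / κ ^ 2 * t * ∫ x in b..X, u' x ^ 2 * exp (-U x / t) := by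
  have hκ := hU.slope_pos
  have hst : 0 < √t := sqrt_pos.2 ht
  have hUc := hU.diff.continuous
  have huc : Continuous u := continuous_iff_continuousAt.2 fun x => (hu x).continuousAt
  -- Integrates the derivative of u² g(y) e^{-y²} with y = √(U/t) and g(y) = y + 2/(1 + y). The
  -- second summand of g keeps P = 2yg - g' above 2y² + 1/2; with g = y alone P would be 2y² - 1,
  -- negative near y = 0. The boundary term vanishes at b and is nonnegative at X.
  have h1 := intervalIntegral.sub_le_integral_of_hasDeriv_right_of_le
    (g := fun x => u x ^ 2 * (√(U x) / √t + 2 / (1 + √(U x) / √t)) * exp (-U x / t))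
    (g' := fun x => 2 * u x * u' x * (√(U x) / √t + 2 / (1 + √(U x) / √t)) * exp (-U x / t) -
      u x ^ 2 * (deriv U x / (2 * √(U x)) / √t) *
        (2 * (√(U x) / √t) * (√(U x) / √t + 2 / (1 + √(U x) / √t)) -
          (1 - 2 / (1 + √(U x) / √t) ^ 2)) * exp (-U x / t))
    (φ := fun x => 32 * √t / κ * (u' x ^ 2 * exp (-U x / t)) -
      κ / (4 * √t) * (u x ^ 2 * (1 + U x / t) * exp (-U x / t))) hX
    (by
      have : ∀ x, 1 + √(U x) / √t ≠ 0 := fun x => by positivity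
      have hsc : Continuous fun x => √(U x) := hUc.sqrt
      exact Continuous.continuousOn (((huc.pow 2).mul ((hsc.div_const _).add
        (continuous_const.div (by fun_prop) this))).mul (by fun_prop)))
    (fun x hx => by
      have hy : HasDerivAt (fun x => √(U x) / √t) (deriv U x / (2 * √(U x)) / √t) x :=
        (hU.hasDerivAt_sqrt hx.1).div_const _
      have hy0 : 1 + √(U x) / √t ≠ 0 := by positivity
      have hg := hy.add ((hasDerivAt_const x (2 : ℝ)).div (hy.const_add 1) hy0)
      have hw : HasDerivAt (fun x => exp (-U x / t)) _ x :=
        ((hU.diff x).hasDerivAt.neg.div_const t).exp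
      refine ((((hu x).pow 2).mul hg).mul hw).hasDerivWithinAt.congr_deriv ?_
      have hs : 0 < √(U x) := sqrt_pos.2 (hU.pos x hx.1)
      have hUx : deriv U x / t = 2 * (√(U x) / √t) * (deriv U x / (2 * √(U x)) / √t) := by
        have : t = √t * √t := (mul_self_sqrt ht.le).symm
        field_simp
        rw [sq_sqrt ht.le]
      have hneg : -deriv U x / t = -(deriv U x / t) := neg_div _ _
      rw [hneg, hUx]
      simp only [Pi.add_apply, Pi.div_apply, Pi.pow_apply, Pi.mul_apply, Pi.neg_apply]
      generalize deriv U x / (2 * √(U x)) / √t = y'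
      generalize √(U x) / √t = y at hy0 ⊢
      field_simp
      ring)
    (Continuous.integrableOn_Icc (by fun_prop))
    (fun x hx => by
      have hw : 0 < exp (-U x / t) := exp_pos _
      have hy' : κ / √t ≤ deriv U x / (2 * √(U x)) / √t := by
        have := hU.le_deriv_sqrt hx.1
        gcongr
      have hUy : U x / t = (√(U x) / √t) ^ 2 := by
        rw [div_pow, sq_sqrt (hU.nonneg hx.1.le), sq_sqrt ht.le]
      have hy0 : 0 ≤ √(U x) / √t := by positivity
      rw [hUy]
      have e1 : 32 * √t / κ = 32 / (κ / √t) := by field_simp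
      have e2 : κ / (4 * √t) = (κ / √t) / 4 := by field_simp
      rw [e1, e2]
      have hk : 0 < κ / √t := by positivity
      generalize deriv U x / (2 * √(U x)) / √t = y' at hy' ⊢
      generalize √(U x) / √t = y at hy0 ⊢
      generalize κ / √t = k at hy' hk ⊢
      generalize exp (-U x / t) = w at hw ⊢
      set g := y + 2 / (1 + y) with hg
      set P := 2 * y * g - (1 - 2 / (1 + y) ^ 2) with hP
      have hPlow : 2 * y ^ 2 + 1 / 2 ≤ P := by
        have : P - (2 * y ^ 2 + 1 / 2) = (5 * y ^ 2 + 2 * y + 1) / (2 * (1 + y) ^ 2) := by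
          rw [hP, hg]; field_simp; ring
        have h2 : 0 ≤ (5 * y ^ 2 + 2 * y + 1) / (2 * (1 + y) ^ 2) := by positivity
        linarith
      have hg2 : g ^ 2 ≤ 16 * P := by
        have h3 : 2 / (1 + y) ≤ 2 := div_le_self (by norm_num) (by linarith)
        have h4 : 0 ≤ 2 / (1 + y) := by positivity
        nlinarith [sq_nonneg (y - 2)]
      have hP0 : 0 ≤ P := by nlinarith [sq_nonneg y]
      have hA : 2 * u x * u' x * g ≤ k / 32 * (u x ^ 2 * g ^ 2) + 32 / k * u' x ^ 2 := by
        have : k / 32 * (u x ^ 2 * g ^ 2) + 32 / k * u' x ^ 2 - 2 * u x * u' x * g =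
            (k * u x * g - 32 * u' x) ^ 2 / (32 * k) := by field_simp; ring
        have h5 : 0 ≤ (k * u x * g - 32 * u' x) ^ 2 / (32 * k) := by positivity
        linarith
      have hB : k / 32 * (u x ^ 2 * g ^ 2) ≤ k / 2 * (u x ^ 2 * P) := by
        have := mul_le_mul_of_nonneg_left hg2 (by positivity : 0 ≤ k / 32 * u x ^ 2)
        linarith
      have hC : k * (u x ^ 2 * P) ≤ u x ^ 2 * y' * P := by
        have := mul_le_mul_of_nonneg_left hy' (by positivity : 0 ≤ u x ^ 2 * P)
        linarith
      have hD : k / 4 * (u x ^ 2 * (1 + y ^ 2)) ≤ k / 2 * (u x ^ 2 * P) := by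
        have := mul_le_mul_of_nonneg_left (by nlinarith [sq_nonneg y] : 1 + y ^ 2 ≤ 2 * P)
          (by positivity : 0 ≤ k / 4 * u x ^ 2)
        linarith
      have hfin : 2 * u x * u' x * g - u x ^ 2 * y' * P ≤
          32 / k * u' x ^ 2 - k / 4 * (u x ^ 2 * (1 + y ^ 2)) := by linarith
      have := mul_le_mul_of_nonneg_right hfin hw.le
      linarith)
  rw [intervalIntegral.integral_sub (Continuous.intervalIntegrable (by fun_prop) _ _)
      (Continuous.intervalIntegrable (by fun_prop) _ _),
    intervalIntegral.integral_const_mul, intervalIntegral.integral_const_mul] at h1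
  simp only [hub] at h1
  have h2 : 0 ≤ u X ^ 2 * (√(U X) / √t + 2 / (1 + √(U X) / √t)) * exp (-U X / t) := by positivity
  set I := ∫ x in b..X, u x ^ 2 * (1 + U x / t) * exp (-U x / t)
  set D := ∫ x in b..X, u' x ^ 2 * exp (-U x / t)
  have h3 : κ / (4 * √t) * I ≤ 32 * √t / κ * D := by
    have : (0 : ℝ) ^ 2 * (√(U b) / √t + 2 / (1 + √(U b) / √t)) * exp (-U b / t) = 0 := by ring
    rw [this] at h1
    linarith
  have h4 := mul_le_mul_of_nonneg_left h3 (by positivity : 0 ≤ 4 * √t / κ)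
  calc I = 4 * √t / κ * (κ / (4 * √t) * I) := by field_simp
    _ ≤ _ := h4
    _ = 128 / κ ^ 2 * (√t * √t) * D := by field_simp; ring
    _ = _ := by rw [mul_self_sqrt ht.le]

/-- Crude pointwise bound for the increments of a function of finite energy. -/
lemma abs_sub_le (hU : TailPotential U b κ) {t x : ℝ} (ht : 0 < t) (hx : b ≤ x) {u u' : ℝ → ℝ}
    (hu : ∀ x, HasDerivAt u (u' x) x) (hu' : Continuous u') :
    2 * |u x - u b| ≤
      (∫ y in b..x, u' y ^ 2 * exp (-U y / t)) + (x - b) * exp (U x / t) := by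
  have hUc := hU.diff.continuous
  have hftc : ∫ y in b..x, u' y = u x - u b :=
    intervalIntegral.integral_eq_sub_of_hasDerivAt (fun y _ => hu y)
      (hu'.intervalIntegrable _ _)
  rw [← hftc]
  have h1 := intervalIntegral.abs_integral_le_integral_abs (f := u') (μ := volume) hx
  -- Pointwise 2|u'| ≤ u'² e^{-U/t} + e^{U/t}, and U is monotone on the tail.
  have h2 : ∫ y in b..x, 2 * |u' y| ≤
      ∫ y in b..x, (u' y ^ 2 * exp (-U y / t) + exp (U x / t)) := by
    refine intervalIntegral.integral_mono_on hx (Continuous.intervalIntegrable (by fun_prop) _ _)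
      (Continuous.intervalIntegrable (by fun_prop) _ _) fun y hy => ?_
    have hle : exp (U y / t) ≤ exp (U x / t) := by
      have := hU.monotoneOn hy.1 hx hy.2
      gcongr
    have he : exp (-U y / t) * exp (U y / t) = 1 := by
      rw [← exp_add, neg_div, neg_add_cancel, exp_zero]
    have hs := sq_nonneg (|u' y| * exp (-U y / t) - 1)
    have hp := exp_pos (U y / t)
    have h3 := mul_nonneg hs hp.le
    have h4 : (|u' y| * exp (-U y / t) - 1) ^ 2 * exp (U y / t) =
        u' y ^ 2 * exp (-U y / t) + exp (U y / t) - 2 * |u' y| := by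
      rw [← sq_abs (u' y)]
      linear_combination (|u' y| ^ 2 * exp (-U y / t) - 2 * |u' y|) * he
    linarith
  rw [intervalIntegral.integral_const_mul, intervalIntegral.integral_add
    (Continuous.intervalIntegrable (by fun_prop) _ _) (by simp),
    intervalIntegral.integral_const, smul_eq_mul] at h2
  linarith

/-- The increment u may be exponentially large in U/t, but its logarithm is only linear in U/t: this
is the weight 1 + U/t that `hardy` controls. Powers of 1/t cost the factor 1 - log t. -/
lemma log_increment_le (hU : TailPotential U b κ) {t x k u K1 : ℝ} (ht : 0 < t) (ht1 : t ≤ 1)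
    (hx : b ≤ x) (hK1 : 0 ≤ K1) (hk : 0 < k) (hlogk : log (1 + k) ≤ K1 * (1 - log t))
    (hu : 2 * |u| ≤ 1 / t + (x - b) * exp (U x / t)) :
    3 + 2 * log (1 + k + 2 * |u|) ≤
      (7 + 2 * K1 + 2 * (log (2 + 1 / κ) + 1)) * (1 - log t) * (1 + U x / t) := by
  have hκ := hU.slope_pos
  have hU0 := hU.nonneg hx
  have hUt : 0 ≤ U x / t := by positivity
  have hlogt : log t ≤ 0 := log_nonpos ht.le ht1
  have hinvt : 1 ≤ 1 / t := by rw [le_div_iff₀ ht]; linarith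
  have h0 := abs_nonneg u
  have h1 : log (1 + k + 2 * |u|) ≤ log (1 + k) + log (1 + 2 * |u|) := by
    rw [← log_mul (by linarith) (by linarith)]
    exact log_le_log (by linarith) (by nlinarith)
  have h3 : x - b ≤ 1 / κ * exp (U x / t) := by
    have h4 := hU.mul_sub_le_sqrt hx
    have h5 : √(U x) ≤ 1 + U x := by
      rw [sqrt_le_iff]; constructor <;> nlinarith
    have h6 : 1 + U x ≤ exp (U x / t) := by
      have h7 : U x ≤ U x / t := by rw [le_div_iff₀ ht]; nlinarith
      linarith [add_one_le_exp (U x / t)]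
    rw [div_mul_eq_mul_div, one_mul, le_div_iff₀ hκ]
    linarith
  have hexp : exp (U x / t) * exp (U x / t) = exp (2 * (U x / t)) := by
    rw [← exp_add, two_mul]
  have h8 : 1 + 2 * |u| ≤ (2 + 1 / κ) / t * exp (2 * (U x / t)) := by
    have he1 : 1 ≤ exp (2 * (U x / t)) := one_le_exp (by positivity)
    have h9 := mul_le_mul_of_nonneg_right h3 (exp_pos (U x / t)).le
    rw [mul_assoc, hexp] at h9
    have h10 : 1 / κ * exp (2 * (U x / t)) ≤ 1 / κ * exp (2 * (U x / t)) * (1 / t) :=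
      le_mul_of_one_le_right (by positivity) hinvt
    have h11 : 2 * (1 / t) ≤ 2 * (1 / t) * exp (2 * (U x / t)) :=
      le_mul_of_one_le_right (by positivity) he1
    calc 1 + 2 * |u| ≤ 2 * (1 / t) + 1 / κ * exp (2 * (U x / t)) := by linarith
      _ ≤ 2 * (1 / t) * exp (2 * (U x / t)) + 1 / κ * exp (2 * (U x / t)) * (1 / t) := by
        linarith
      _ = _ := by ring
  have h12 := log_le_log (by linarith) h8
  rw [log_mul (by positivity) (exp_pos _).ne', log_exp, log_div (by positivity) ht.ne'] at h12
  have hκ' : 0 ≤ log (2 + 1 / κ) :=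
    log_nonneg (by have : 0 < 1 / κ := by positivity
                   linarith)
  generalize log (2 + 1 / κ) = c at h12 hκ' ⊢
  generalize U x / t = v at h12 hUt ⊢
  obtain ⟨Λ, hΛ⟩ : ∃ Λ, Λ = 1 - log t := ⟨_, rfl⟩
  rw [← hΛ] at hlogk ⊢
  have hΛ1 : 1 ≤ Λ := by linarith
  have h13 : c - log t ≤ (c + 1) * Λ := by nlinarith
  have h14 : 3 + 2 * log (1 + k + 2 * |u|) ≤ 3 + 2 * (K1 * Λ) + 2 * ((c + 1) * Λ) + 4 * v := by
    linarith
  have h15 : v ≤ Λ * v := le_mul_of_one_le_left hUt hΛ1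
  have h16 : 0 ≤ (3 + 2 * K1 + 2 * (c + 1)) * Λ * v := by positivity
  nlinarith

set_option maxHeartbeats 1000000 in
/-- The contribution of the tail to the entropy is negligible. -/
theorem tail_entropy_le (hU : TailPotential U b κ) {J d : ℝ} (hJ : 0 ≤ J) (hd : 0 ≤ d) :
    ∃ K : ℝ, 0 ≤ K ∧ ∀ t : ℝ, 0 < t → t ≤ 1 → ∀ X : ℝ, b ≤ X → ∀ E : ℝ, 0 ≤ E → E ≤ 1 / t →
      ∀ H H' : ℝ → ℝ, (∀ x, HasDerivAt H (H' x) x) → Continuous H' → (∀ x, 0 < H x) →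
      ∫ x in b..X, H' x ^ 2 * exp (-U x / t) ≤ E → |H b - 1| ≤ J * √E →
      ∫ x in b..X, exp (-U x / t) ≤ d * √t →
      ∫ x in b..X, (psi (H x) - psi (H b)) * exp (-U x / t) ≤
        K * (√t * √√t * (1 - log t)) * E := by
  have hκ := hU.slope_pos
  have hUc := hU.diff.continuous
  set K1 := log (2 + J) + 1 with hK1
  have hK1' : 0 ≤ K1 := by have := log_nonneg (by linarith : (1 : ℝ) ≤ 2 + J); linarith
  have hK3' : 0 ≤ log (2 + 1 / κ) + 1 := by
    have := log_nonneg (by have : 0 < 1 / κ := by positivity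
                           linarith : (1 : ℝ) ≤ 2 + 1 / κ)
    linarith
  obtain ⟨K2, hK2⟩ : ∃ K2, K2 = 7 + 2 * K1 + 2 * (log (2 + 1 / κ) + 1) := ⟨_, rfl⟩
  have hK2' : 0 ≤ K2 := by rw [hK2]; positivity
  refine ⟨2 * J * (1 + K1) * d + (2 * J * (1 + K1) + K2) * (128 / κ ^ 2), by positivity, ?_⟩
  intro t ht ht1 X hX E hE hEt H H' hH hH' hpos hHE hHb hw
  have hHc : Continuous H := continuous_iff_continuousAt.2 fun x => (hH x).continuousAt
  set Λ := 1 - log t with hΛ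
  have hlogt : log t ≤ 0 := log_nonpos ht.le ht1
  have hΛ1 : 1 ≤ Λ := by linarith
  have hinvt : 1 ≤ 1 / t := by rw [le_div_iff₀ ht]; linarith
  have hsE : √E ≤ 1 / t := by
    refine sqrt_le_iff.2 ⟨by positivity, hEt.trans ?_⟩
    nlinarith
  have hk := hpos b
  set k := H b with hkdef
  have hlogk : log (1 + k) ≤ K1 * Λ := by
    have h1 : 1 + k ≤ (2 + J) / t := by
      have h2 := (abs_le.1 hHb).2
      have h3 := mul_le_mul_of_nonneg_left hsE hJ
      calc 1 + k ≤ 2 * 1 + J * (1 / t) := by linarith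
        _ ≤ 2 * (1 / t) + J * (1 / t) := by linarith
        _ = _ := by ring
    have h2 := log_le_log (by linarith) h1
    rw [log_div (by linarith) ht.ne'] at h2
    have : 0 ≤ log (2 + J) := log_nonneg (by linarith)
    rw [hK1, hΛ]
    nlinarith
  have hlogk0 : 0 ≤ log (1 + k) := log_nonneg (by linarith)
  -- The parameter r = t^{1/4} in 2√E|u| ≤ rE + u²/r balances the two contributions: r√t E from the
  -- tail mass and (t/r)E from Hardy.
  have hr : 0 < √√t := sqrt_pos.2 (sqrt_pos.2 ht)
  set r := √√t with hrdef
  have hr2 : r * r = √t := mul_self_sqrt (sqrt_nonneg _)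
  have hr4 : r ^ 4 = t := by
    calc r ^ 4 = (r * r) * (r * r) := by ring
      _ = t := by rw [hr2, mul_self_sqrt ht.le]
  have hpt : ∀ x ∈ Icc b X, (psi (H x) - psi k) * exp (-U x / t) ≤
      2 * J * (1 + K1) * Λ * r * E * exp (-U x / t) +
        (2 * J * (1 + K1) * Λ / r + K2 * Λ) *
          ((H x - k) ^ 2 * (1 + U x / t) * exp (-U x / t)) := by
    intro x hx
    have hU0 := hU.nonneg hx.1
    have hUt : 0 ≤ U x / t := by positivity
    set u := H x - k with hu
    have hψ := psi_add_sub_le (u := u) hk (by rw [hu]; linarith [hpos x])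
    rw [show k + u = H x by rw [hu]; ring] at hψ
    have hlin : 4 * (k * log k) * u ≤ 2 * J * (1 + K1) * Λ * (r * E + u ^ 2 / r) := by
      have h1 := abs_mul_log_le hk
      have h2 : |k - 1| * (1 + log (1 + k)) ≤ J * √E * ((1 + K1) * Λ) := by
        refine mul_le_mul hHb (by nlinarith) (by linarith) (by positivity)
      have h3 : 2 * (√E * |u|) ≤ r * E + u ^ 2 / r := by
        have : r * E + u ^ 2 / r - 2 * (√E * |u|) = (r * √E - |u|) ^ 2 / r := by
          rw [sub_sq (r * √E) |u|, mul_pow, sq_sqrt hE, sq_abs]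
          field_simp
          ring
        have h4 : 0 ≤ (r * √E - |u|) ^ 2 / r := by positivity
        linarith
      calc 4 * (k * log k) * u ≤ |4 * (k * log k) * u| := le_abs_self _
        _ = 4 * |k * log k| * |u| := by rw [abs_mul, abs_mul, abs_of_pos (by norm_num : (0:ℝ) < 4)]
        _ ≤ 4 * (J * √E * ((1 + K1) * Λ)) * |u| := by gcongr; exact h1.trans h2
        _ = 2 * J * (1 + K1) * Λ * (2 * (√E * |u|)) := by ring
        _ ≤ _ := mul_le_mul_of_nonneg_left h3 (by positivity)
    have hlog : 3 + 2 * log (1 + k + 2 * |u|) ≤ K2 * Λ * (1 + U x / t) := by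
      rw [hK2]
      refine hU.log_increment_le ht ht1 hx.1 hK1' hk hlogk ?_
      refine (hU.abs_sub_le ht hx.1 hH hH').trans ?_
      gcongr
      refine le_trans ?_ (hHE.trans hEt)
      refine intervalIntegral.integral_mono_interval le_rfl hx.1 hx.2
        (Eventually.of_forall fun y => ?_) (Continuous.intervalIntegrable (by fun_prop) _ _)
      simp only [Pi.zero_apply]
      positivity
    have htot : psi (H x) - psi k ≤ 2 * J * (1 + K1) * Λ * r * E +
        (2 * J * (1 + K1) * Λ / r + K2 * Λ) * (u ^ 2 * (1 + U x / t)) := by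
      have h1 := mul_le_mul_of_nonneg_left hlog (sq_nonneg u)
      have h2 : u ^ 2 ≤ u ^ 2 * (1 + U x / t) :=
        le_mul_of_one_le_right (sq_nonneg u) (by linarith)
      have h3 := mul_le_mul_of_nonneg_left h2
        (by positivity : 0 ≤ 2 * J * (1 + K1) * Λ / r)
      have h4 : 2 * J * (1 + K1) * Λ * (r * E + u ^ 2 / r) =
        2 * J * (1 + K1) * Λ * r * E + 2 * J * (1 + K1) * Λ / r * u ^ 2 := by ring
      nlinarith
    have := mul_le_mul_of_nonneg_right htot (exp_pos (-U x / t)).le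
    linarith
  have hψc : Continuous fun x => psi (H x) := continuous_psi.comp hHc
  refine (intervalIntegral.integral_mono_on hX (Continuous.intervalIntegrable (by fun_prop) _ _)
    (Continuous.intervalIntegrable (by fun_prop) _ _) hpt).trans ?_
  rw [intervalIntegral.integral_add (Continuous.intervalIntegrable (by fun_prop) _ _)
    (Continuous.intervalIntegrable (by fun_prop) _ _),
    intervalIntegral.integral_const_mul, intervalIntegral.integral_const_mul]
  have hhardy := hU.hardy ht hX (fun x => (hH x).sub_const k) hH' (sub_self _)
  have h1 : ∫ x in b..X, (H x - k) ^ 2 * (1 + U x / t) * exp (-U x / t) ≤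
      128 / κ ^ 2 * t * E :=
    hhardy.trans (mul_le_mul_of_nonneg_left hHE (by positivity))
  have h2 := mul_le_mul_of_nonneg_left hw
    (by positivity : 0 ≤ 2 * J * (1 + K1) * Λ * r * E)
  have h3 := mul_le_mul_of_nonneg_left h1
    (by positivity : 0 ≤ 2 * J * (1 + K1) * Λ / r + K2 * Λ)
  refine (add_le_add h2 h3).trans ?_
  have hr1 : r ≤ 1 := by
    rw [hrdef]; exact sqrt_le_one.2 (sqrt_le_one.2 ht1)
  rw [← hr2, ← hr4]
  have e1 : 2 * J * (1 + K1) * Λ / r * (128 / κ ^ 2 * r ^ 4 * E) =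
      2 * J * (1 + K1) * (128 / κ ^ 2) * (r * r * r * Λ) * E := by
    field_simp
  have e2 : K2 * Λ * (128 / κ ^ 2 * r ^ 4 * E) ≤ K2 * (128 / κ ^ 2) * (r * r * r * Λ) * E := by
    have : K2 * Λ * (128 / κ ^ 2 * r ^ 4 * E) = K2 * (128 / κ ^ 2) * (r * r * r * Λ) * E * r := by
      ring
    rw [this]
    exact mul_le_of_le_one_right (by positivity) hr1
  calc _ = 2 * J * (1 + K1) * d * (r * r * r * Λ) * E +
        (2 * J * (1 + K1) * Λ / r * (128 / κ ^ 2 * r ^ 4 * E) +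
          K2 * Λ * (128 / κ ^ 2 * r ^ 4 * E)) := by ring
    _ ≤ 2 * J * (1 + K1) * d * (r * r * r * Λ) * E +
        (2 * J * (1 + K1) * (128 / κ ^ 2) * (r * r * r * Λ) * E +
          K2 * (128 / κ ^ 2) * (r * r * r * Λ) * E) := by rw [e1]; linarith
    _ = _ := by ring

end TailPotential
end Tail

/-! ### Laplace asymptotics and splitting of a well -/

section Laplace
open Real Set

namespace TailPotential

variable {U : ℝ → ℝ} {b κ : ℝ}

lemma exp_le (hU : TailPotential U b κ) {t x : ℝ} (ht : 0 < t) (hx : b ≤ x) :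
    exp (-U x / t) ≤ exp (-(κ ^ 2 / t) * (x - b) ^ 2) := by
  have h := hU.sq_le hx
  refine exp_le_exp.2 ?_
  rw [neg_div, neg_mul, neg_le_neg_iff, div_mul_eq_mul_div]
  gcongr

lemma integrableOn_exp (hU : TailPotential U b κ) {t : ℝ} (ht : 0 < t) :
    IntegrableOn (fun x => exp (-U x / t)) (Ioi b) := by
  have hκ := hU.slope_pos
  have hUc := hU.diff.continuous
  have h1 : Integrable fun x : ℝ => exp (-(κ ^ 2 / t) * (x - b) ^ 2) :=
    (integrable_exp_neg_mul_sq (by positivity : 0 < κ ^ 2 / t)).comp_sub_right b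
  refine h1.integrableOn.mono' (Continuous.aestronglyMeasurable (by fun_prop)) ?_
  filter_upwards [ae_restrict_mem measurableSet_Ioi] with x hx
  rw [norm_of_nonneg (exp_pos _).le]
  exact hU.exp_le ht (le_of_lt hx)

/-- Laplace asymptotics at a half-line minimum. -/
lemma tendsto_laplace (hU : TailPotential U b κ) {D : ℝ}
    (hD : Tendsto (fun x => U x / (x - b) ^ 2) (𝓝[>] b) (𝓝 (D / 2))) {φ : ℝ → ℝ}
    (hφ : Continuous φ) {M : ℝ} (hM : ∀ x, |φ x| ≤ M) :
    Tendsto (fun t => (∫ x in Ioi b, φ x * exp (-U x / t)) / √t) (𝓝[>] 0)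
      (𝓝 (φ b * (√(π / (D / 2)) / 2))) := by
  have hκ := hU.slope_pos
  have hUc := hU.diff.continuous
  have hcv : ∀ t : ℝ, 0 < t → (∫ x in Ioi b, φ x * exp (-U x / t)) / √t =
      ∫ z in Ioi (0 : ℝ), φ (b + √t * z) * exp (-U (b + √t * z) / t) := by
    intro t ht
    have hs : 0 < √t := sqrt_pos.2 ht
    have h1 := integral_comp_mul_left_Ioi
      (fun y => φ (b + y) * exp (-U (b + y) / t)) 0 hs
    have h2 := (measurePreserving_add_left volume b).setIntegral_preimage_emb
      (measurableEmbedding_addLeft b) (fun y => φ y * exp (-U y / t)) (Ioi b)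
    rw [preimage_const_add_Ioi, sub_self] at h2
    rw [mul_zero, h2, smul_eq_mul] at h1
    rw [h1, div_eq_inv_mul]
  have hlim : Tendsto (fun t => ∫ z in Ioi (0 : ℝ), φ (b + √t * z) * exp (-U (b + √t * z) / t))
      (𝓝[>] 0) (𝓝 (∫ z in Ioi (0 : ℝ), φ b * exp (-(D / 2) * z ^ 2))) := by
    -- In the variable z = (x - b)/√t, the growth U ≥ κ²(x - b)² gives a Gaussian majorant
    -- independent of t.
    refine tendsto_integral_filter_of_dominated_convergence
      (fun z => M * exp (-(κ ^ 2) * z ^ 2)) ?_ ?_ ?_ ?_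
    · exact Eventually.of_forall fun t => Continuous.aestronglyMeasurable (by fun_prop)
    · filter_upwards [self_mem_nhdsWithin] with t ht
      rw [mem_Ioi] at ht
      filter_upwards [ae_restrict_mem measurableSet_Ioi] with z hz
      rw [mem_Ioi] at hz
      have hs : 0 < √t := sqrt_pos.2 ht
      rw [norm_mul, Real.norm_eq_abs, norm_of_nonneg (exp_pos _).le]
      refine mul_le_mul (hM _) ?_ (exp_pos _).le ((abs_nonneg _).trans (hM 0))
      refine (hU.exp_le ht (by nlinarith)).trans_eq ?_
      congr 1
      rw [add_sub_cancel_left, mul_pow, sq_sqrt ht.le]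
      field_simp
    · exact ((integrable_exp_neg_mul_sq (by positivity : 0 < κ ^ 2)).const_mul M).integrableOn
    · filter_upwards [ae_restrict_mem measurableSet_Ioi] with z hz
      rw [mem_Ioi] at hz
      have hst : Tendsto (fun t : ℝ => b + √t * z) (𝓝[>] 0) (𝓝 b) := by
        have : Continuous fun t : ℝ => b + √t * z := by fun_prop
        have h := this.tendsto 0
        simp only [sqrt_zero, zero_mul, add_zero] at h
        exact h.mono_left nhdsWithin_le_nhds
      have hst' : Tendsto (fun t : ℝ => b + √t * z) (𝓝[>] 0) (𝓝[>] b) := by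
        refine tendsto_nhdsWithin_iff.2 ⟨hst, ?_⟩
        filter_upwards [self_mem_nhdsWithin] with t ht
        rw [mem_Ioi] at ht ⊢
        have hs : 0 < √t := sqrt_pos.2 ht
        nlinarith
      refine ((hφ.tendsto b).comp hst).mul ?_
      refine (continuous_exp.tendsto _).comp ?_
      have h2 := ((hD.comp hst').mul_const (z ^ 2)).neg
      rw [← neg_mul] at h2
      refine h2.congr' ?_
      filter_upwards [self_mem_nhdsWithin] with t ht
      rw [mem_Ioi] at ht
      simp only [Function.comp_apply]
      rw [add_sub_cancel_left, mul_pow, sq_sqrt ht.le]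
      field_simp
  rw [integral_const_mul, integral_gaussian_Ioi] at hlim
  refine hlim.congr' ?_
  filter_upwards [self_mem_nhdsWithin] with t ht using (hcv t ht).symm

/-- The quadratic lower bound on U passes to the limit and gives D/2 ≥ κ²; this is where positivity
of the one-sided second derivatives comes from. -/
lemma pos_of_tendsto (hU : TailPotential U b κ) {D : ℝ}
    (hD : Tendsto (fun x => U x / (x - b) ^ 2) (𝓝[>] b) (𝓝 (D / 2))) : 0 < D := by
  have hκ := hU.slope_pos
  have h : κ ^ 2 ≤ D / 2 := by
    refine ge_of_tendsto hD ?_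
    filter_upwards [self_mem_nhdsWithin] with x hx
    rw [mem_Ioi] at hx
    have : 0 < (x - b) ^ 2 := pow_pos (sub_pos.2 hx) 2
    rw [le_div_iff₀ this]
    exact hU.sq_le hx.le
  have : 0 < κ ^ 2 := by positivity
  linarith

end TailPotential

/-- A potential vanishing exactly on `[a, b]`, with tails on both sides. -/
structure WellPotential (U : ℝ → ℝ) (a b κ : ℝ) : Prop where
  lt : a < b
  right : TailPotential U b κ
  left : TailPotential (fun x => U (-x)) (-a) κ
  zero : ∀ x ∈ Icc a b, U x = 0

/-- The mass of the tail `(b, ∞)` at temperature `t`. -/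
noncomputable def tailMass (U : ℝ → ℝ) (b t : ℝ) : ℝ := ∫ x in Ioi b, exp (-U x / t)

lemma tailMass_nonneg (U : ℝ → ℝ) (b t : ℝ) : 0 ≤ tailMass U b t :=
  integral_nonneg fun _ => (exp_pos _).le

namespace WellPotential

variable {U : ℝ → ℝ} {a b κ : ℝ}

lemma continuous (hU : WellPotential U a b κ) : Continuous U := hU.right.diff.continuous

lemma nonneg (hU : WellPotential U a b κ) (x : ℝ) : 0 ≤ U x := by
  rcases le_total b x with h | h
  · exact hU.right.nonneg h
  · rcases le_total a x with h' | h'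
    · exact (hU.zero x ⟨h', h⟩).ge
    · have := hU.left.nonneg (x := -x) (by linarith)
      simpa using this

lemma integrable_exp (hU : WellPotential U a b κ) {t : ℝ} (ht : 0 < t) :
    Integrable fun x => exp (-U x / t) := by
  have hUc := hU.continuous
  have h1 : IntegrableOn (fun x => exp (-U x / t)) (Iic a) := by
    have hκ := hU.right.slope_pos
    have h1 : Integrable fun x : ℝ => exp (-(κ ^ 2 / t) * (x - a) ^ 2) :=
      (integrable_exp_neg_mul_sq (by positivity : 0 < κ ^ 2 / t)).comp_sub_right a
    refine h1.integrableOn.mono' (Continuous.aestronglyMeasurable (by fun_prop)) ?_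
    filter_upwards [ae_restrict_mem measurableSet_Iic] with x hx
    rw [mem_Iic] at hx
    rw [norm_of_nonneg (exp_pos _).le]
    have := hU.left.exp_le ht (x := -x) (by linarith)
    rw [neg_neg] at this
    refine this.trans_eq ?_
    congr 1; ring
  have h2 : IntegrableOn (fun x => exp (-U x / t)) (Icc a b) :=
    Continuous.integrableOn_Icc (by fun_prop)
  have h3 := (h1.union h2).union (hU.right.integrableOn_exp ht)
  rwa [Iic_union_Icc_eq_Iic hU.lt.le, Iic_union_Ioi, integrableOn_univ] at h3

/-- Integration of bounded continuous functions against the Gibbs weight. -/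
lemma integrable_mul_exp (hU : WellPotential U a b κ) {t : ℝ} (ht : 0 < t) {F : ℝ → ℝ}
    (hF : Continuous F) {M : ℝ} (hM : ∀ x, |F x| ≤ M) :
    Integrable fun x => F x * exp (-U x / t) :=
  (hU.integrable_exp ht).bdd_mul hF.aestronglyMeasurable (Eventually.of_forall hM)

lemma integral_split (hU : WellPotential U a b κ) {t : ℝ} {F : ℝ → ℝ}
    (hi : Integrable fun x => F x * exp (-U x / t)) :
    ∫ x, F x * exp (-U x / t) = (∫ x in a..b, F x) +
      (∫ x in Ioi b, F x * exp (-U x / t)) +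
      ∫ x in Ioi (-a), F (-x) * exp (-U (-x) / t) := by
  have h1 := integral_comp_neg_Ioi (-a) fun x => F x * exp (-U x / t)
  rw [neg_neg] at h1
  have h2 := intervalIntegral.integral_Iic_add_Ioi (b := b) hi.integrableOn hi.integrableOn
  have h3 := intervalIntegral.integral_Iic_sub_Iic (a := a) (b := b) hi.integrableOn hi.integrableOn
  have h4 : ∫ x in a..b, F x * exp (-U x / t) = ∫ x in a..b, F x := by
    refine intervalIntegral.integral_congr fun x hx => ?_
    rw [uIcc_of_le hU.lt.le] at hx
    simp [hU.zero x hx]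
  rw [← h2, h1, ← h4, ← h3]
  ring

lemma integral_exp (hU : WellPotential U a b κ) {t : ℝ} (ht : 0 < t) :
    ∫ x, exp (-U x / t) =
      (b - a) + tailMass U b t + tailMass (fun x => U (-x)) (-a) t := by
  have h := hU.integral_split (t := t) (F := fun _ => 1) (by simpa using hU.integrable_exp ht)
  simpa [tailMass] using h

end WellPotential
end Laplace

/-! ### From log-Sobolev to Poincaré -/

section Linearization
open Real Set

/-- A logarithmic Sobolev inequality extends from compactly supported to bounded smooth functions
with bounded derivative. -/
lemma SatisfiesLSI.of_bounded {μ : Measure ℝ} [IsFiniteMeasure μ] {C : ℝ} (hC : SatisfiesLSI μ C)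
    {h : ℝ → ℝ} (hh : ContDiff ℝ ∞ h) {B B' : ℝ} (hB : ∀ x, |h x| ≤ B)
    (hB' : ∀ x, |deriv h x| ≤ B') :
    entropySq μ h ≤ 2 * C * ∫ x, (deriv h x) ^ 2 ∂μ := by
  have hB0 : 0 ≤ B := (abs_nonneg _).trans (hB 0)
  have hB0' : 0 ≤ B' := (abs_nonneg _).trans (hB' 0)
  let χ : ContDiffBump (0 : ℝ) := ⟨1, 2, one_pos, by norm_num⟩
  have hχ : ContDiff ℝ ∞ χ := χ.contDiff
  have hχd : Differentiable ℝ χ := hχ.differentiable (by simp)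
  have hhd : Differentiable ℝ h := hh.differentiable (by simp)
  have hχ'c : Continuous (deriv χ) := hχ.continuous_deriv (by simp)
  have hh'c : Continuous (deriv h) := hh.continuous_deriv (by simp)
  obtain ⟨D, hD⟩ := hχ'c.bounded_above_of_compact_support χ.hasCompactSupport.deriv
  have hD0 : 0 ≤ D := (norm_nonneg _).trans (hD 0)
  let c : ℕ → ℝ := fun n => 1 / ((n : ℝ) + 1)
  have hc0 : ∀ n, 0 < c n := fun n => by positivity
  have hc1 : ∀ n, c n ≤ 1 := fun n => by
    rw [div_le_one (by positivity)]; linarith [n.cast_nonneg (α := ℝ)]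
  have hc : Tendsto c atTop (𝓝 0) := tendsto_one_div_add_atTop_nhds_zero_nat
  let H : ℕ → ℝ → ℝ := fun n x => h x * χ (c n * x)
  have hHs : ∀ n, ContDiff ℝ ∞ (H n) := fun n => hh.mul (hχ.comp (contDiff_const.mul contDiff_id))
  have hHsupp : ∀ n, HasCompactSupport (H n) := fun n =>
    (χ.hasCompactSupport.comp_smul (hc0 n).ne').mul_left
  have hHd : ∀ n x, HasDerivAt (H n)
      (deriv h x * χ (c n * x) + h x * (deriv χ (c n * x) * (c n * 1))) x := fun n x =>
    (hhd x).hasDerivAt.mul ((hχd _).hasDerivAt.comp x ((hasDerivAt_id x).const_mul (c n)))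
  have hχle : ∀ x, |χ x| ≤ 1 := fun x => by rw [abs_of_nonneg χ.nonneg]; exact χ.le_one
  have hcx : ∀ x, Tendsto (fun n => c n * x) atTop (𝓝 0) := fun x => by
    simpa using hc.mul_const x
  have hχlim : ∀ x, Tendsto (fun n => χ (c n * x)) atTop (𝓝 1) := fun x => by
    have h1 : χ 0 = 1 := χ.one_of_mem_closedBall (by simp [χ.rIn_pos.le])
    have h2 := (hχd.continuous.tendsto 0).comp (hcx x)
    rwa [h1] at h2
  have hHlim : ∀ x, Tendsto (fun n => H n x) atTop (𝓝 (h x)) := fun x => by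
    simpa using (hχlim x).const_mul (h x)
  have hHdlim : ∀ x, Tendsto (fun n => deriv (H n) x) atTop (𝓝 (deriv h x)) := fun x => by
    have h1 := ((hχlim x).const_mul (deriv h x)).add
      ((((hχ'c.tendsto 0).comp (hcx x)).mul (hc.mul_const 1)).const_mul (h x))
    simp only [mul_one, mul_zero, add_zero] at h1
    refine h1.congr fun n => ?_
    rw [(hHd n x).deriv]; simp
  have hHB : ∀ n x, |H n x| ≤ B := fun n x => by
    rw [abs_mul]
    exact (mul_le_mul (hB x) (hχle _) (abs_nonneg _) hB0).trans_eq (mul_one B)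
  have hHB' : ∀ n x, |deriv (H n) x| ≤ B' + B * D := fun n x => by
    rw [(hHd n x).deriv]
    refine (abs_add_le _ _).trans ?_
    rw [abs_mul, abs_mul, abs_mul]
    have e1 : |deriv h x| * |χ (c n * x)| ≤ B' * 1 :=
      mul_le_mul (hB' x) (hχle _) (abs_nonneg _) hB0'
    have e2 : |h x| * (|deriv χ (c n * x)| * |c n * 1|) ≤ B * (D * 1) := by
      refine mul_le_mul (hB x) ?_ (by positivity) hB0
      refine mul_le_mul (hD _) ?_ (abs_nonneg _) hD0
      rw [mul_one, abs_of_pos (hc0 n)]; exact hc1 n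
    linarith
  have hsq : ∀ {y K : ℝ}, |y| ≤ K → y ^ 2 ≤ K ^ 2 := fun {y K} hy => by
    rw [← sq_abs]; gcongr
  obtain ⟨Q, hQ⟩ := (isCompact_Icc (a := (0 : ℝ)) (b := B ^ 2)).exists_bound_of_continuousOn
    continuous_mul_log.continuousOn
  have L1 : Tendsto (fun n => ∫ x, H n x ^ 2 ∂μ) atTop (𝓝 (∫ x, h x ^ 2 ∂μ)) := by
    refine tendsto_integral_of_dominated_convergence (fun _ => B ^ 2)
      (fun n => ((hHs n).continuous.pow 2).aestronglyMeasurable) (integrable_const _)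
      (fun n => Eventually.of_forall fun x => ?_)
      (Eventually.of_forall fun x => (hHlim x).pow 2)
    rw [norm_of_nonneg (sq_nonneg _)]; exact hsq (hHB n x)
  have L2 : Tendsto (fun n => ∫ x, H n x ^ 2 * log (H n x ^ 2) ∂μ) atTop
      (𝓝 (∫ x, h x ^ 2 * log (h x ^ 2) ∂μ)) := by
    refine tendsto_integral_of_dominated_convergence (fun _ => Q)
      (fun n => (continuous_mul_log.comp ((hHs n).continuous.pow 2)).aestronglyMeasurable)
      (integrable_const _)
      (fun n => Eventually.of_forall fun x => hQ _ ⟨sq_nonneg _, hsq (hHB n x)⟩)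
      (Eventually.of_forall fun x =>
        (continuous_mul_log.tendsto _).comp ((hHlim x).pow 2))
  have L3 : Tendsto (fun n => ∫ x, deriv (H n) x ^ 2 ∂μ) atTop (𝓝 (∫ x, deriv h x ^ 2 ∂μ)) := by
    refine tendsto_integral_of_dominated_convergence (fun _ => (B' + B * D) ^ 2)
      (fun n => (((hHs n).continuous_deriv (by simp)).pow 2).aestronglyMeasurable)
      (integrable_const _)
      (fun n => Eventually.of_forall fun x => ?_)
      (Eventually.of_forall fun x => (hHdlim x).pow 2)
    rw [norm_of_nonneg (sq_nonneg _)]; exact hsq (hHB' n x)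
  refine le_of_tendsto_of_tendsto' (L2.sub ((continuous_mul_log.tendsto _).comp L1))
    (L3.const_mul (2 * C)) fun n => hC (H n) (hHs n) (hHsupp n)

/-- Taylor expansion at 1 with cubic error, for use at x = (1 + εf)², where x - 1 = O(ε). -/
lemma mul_log_ge {x : ℝ} (hx : |x - 1| ≤ 1 / 2) :
    (x - 1) + (x - 1) ^ 2 / 2 - 4 * |x - 1| ^ 3 ≤ x * log x := by
  have h1 : |1 - x| < 1 := by rw [abs_sub_comm]; linarith
  have h := abs_log_sub_add_sum_range_le h1 2
  rw [sub_sub_cancel, abs_sub_comm 1 x] at h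
  simp only [Finset.sum_range_succ, Finset.sum_range_zero] at h
  norm_num at h
  have h2 : |x - 1| ^ 3 / (1 - |x - 1|) ≤ 2 * |x - 1| ^ 3 := by
    rw [div_le_iff₀ (by linarith)]
    nlinarith [pow_nonneg (abs_nonneg (x - 1)) 3]
  have h3 := (abs_le.1 (h.trans h2)).1
  have hx0 := abs_le.1 hx
  have hx1 : 0 < x := by linarith [hx0.1]
  have h4 : 0 ≤ x * (1 - x + (1 - x) ^ 2 / 2 + log x + 2 * |x - 1| ^ 3) :=
    mul_nonneg hx1.le (by linarith)
  have h5 : (x - 1) ^ 3 ≤ |x - 1| ^ 3 := by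
    rw [← abs_pow]; exact le_abs_self _
  have h6 : x * |x - 1| ^ 3 ≤ 3 / 2 * |x - 1| ^ 3 := by
    have := pow_nonneg (abs_nonneg (x - 1)) 3
    nlinarith [hx0.2]
  nlinarith

/-- A logarithmic Sobolev inequality implies the Poincaré inequality with the same constant. -/
lemma SatisfiesLSI.poincare_of_integral_eq_zero {μ : Measure ℝ} [IsProbabilityMeasure μ] {C : ℝ}
    (hC : SatisfiesLSI μ C) {f : ℝ → ℝ} (hf : ContDiff ℝ ∞ f) {B B' : ℝ} (hB : ∀ x, |f x| ≤ B)
    (hB' : ∀ x, |deriv f x| ≤ B') (h0 : ∫ x, f x ∂μ = 0) :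
    ∫ x, f x ^ 2 ∂μ ≤ C * ∫ x, (deriv f x) ^ 2 ∂μ := by
  have hB0 : 0 ≤ B := (abs_nonneg _).trans (hB 0)
  have hfd : Differentiable ℝ f := hf.differentiable (by simp)
  have hfc := hfd.continuous
  set v := ∫ x, f x ^ 2 ∂μ with hv
  set e := ∫ x, (deriv f x) ^ 2 ∂μ with he
  have hsq : ∀ x, f x ^ 2 ≤ B ^ 2 := fun x => by
    rw [← sq_abs]; have := hB x; gcongr
  have if1 : Integrable f μ := Integrable.of_bound hfc.aestronglyMeasurable B
    (Eventually.of_forall hB)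
  have if2 : Integrable (fun x => f x ^ 2) μ :=
    Integrable.of_bound (hfc.pow 2).aestronglyMeasurable (B ^ 2) (Eventually.of_forall fun x => by
      rw [norm_of_nonneg (sq_nonneg _)]; exact hsq x)
  set K := 2 * B + B ^ 2 with hK
  have hK0 : 0 ≤ K := by positivity
  -- The test function is 1 + εf with f centred: its entropy is 2ε²v up to O(ε³) and its energy is
  -- ε²e, so the factor 2 of the inequality cancels.
  have key : ∀ ε : ℝ, 0 < ε → ε ≤ 1 → ε * K ≤ 1 / 2 →
      v - (B ^ 3 + 2 * K ^ 3) * ε - ε ^ 2 * v ^ 2 / 2 ≤ C * e := by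
    intro ε hε hε1 hεK
    have hg : ∀ x, |(1 + ε * f x) ^ 2 - 1| ≤ ε * K := fun x => by
      rw [show (1 + ε * f x) ^ 2 - 1 = ε * (2 * f x + ε * f x ^ 2) by ring, abs_mul, abs_of_pos hε]
      refine mul_le_mul_of_nonneg_left ((abs_add_le _ _).trans ?_) hε.le
      rw [abs_mul, abs_two, abs_of_nonneg (by positivity : 0 ≤ ε * f x ^ 2)]
      have := hB x
      have := hsq x
      nlinarith [sq_nonneg (f x)]
    have hpt : ∀ x, 2 * ε * f x + (3 * ε ^ 2) * f x ^ 2 - (2 * B ^ 3 + 4 * K ^ 3) * ε ^ 3 ≤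
        (1 + ε * f x) ^ 2 * log ((1 + ε * f x) ^ 2) := fun x => by
      refine le_trans ?_ (mul_log_ge ((hg x).trans hεK))
      have h1 : |(1 + ε * f x) ^ 2 - 1| ^ 3 ≤ (ε * K) ^ 3 :=
        pow_le_pow_left₀ (abs_nonneg _) (hg x) 3
      have h2 : -(B ^ 3) ≤ f x ^ 3 := by
        have h3 : |f x ^ 3| ≤ B ^ 3 := by
          rw [abs_pow]; exact pow_le_pow_left₀ (abs_nonneg _) (hB x) 3
        exact (abs_le.1 h3).1
      have h4 := mul_le_mul_of_nonneg_left h2 (by positivity : 0 ≤ 2 * ε ^ 3)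
      have h5 : 0 ≤ ε ^ 4 * f x ^ 4 := by positivity
      nlinarith
    have hLSI := SatisfiesLSI.of_bounded hC (h := fun x => 1 + ε * f x)
      (contDiff_const.add (contDiff_const.mul hf)) (B := 1 + B) (B' := B')
      (fun x => (abs_add_le _ _).trans (by
        rw [abs_one, abs_mul, abs_of_pos hε]
        have := hB x
        nlinarith [abs_nonneg (f x)]))
      (fun x => by
        rw [deriv_const_add, deriv_const_mul _ (hfd x), abs_mul, abs_of_pos hε]
        have := hB' x
        nlinarith [abs_nonneg (deriv f x)])
    have hder : ∫ x, (deriv (fun x => 1 + ε * f x) x) ^ 2 ∂μ = ε ^ 2 * e := by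
      rw [he, ← integral_const_mul]
      refine integral_congr_ae (Eventually.of_forall fun x => ?_)
      simp only
      rw [deriv_const_add, deriv_const_mul _ (hfd x), mul_pow]
    have hm : ∫ x, (1 + ε * f x) ^ 2 ∂μ = 1 + ε ^ 2 * v := by
      have : (fun x => (1 + ε * f x) ^ 2) = fun x => 1 + (2 * ε) * f x + ε ^ 2 * f x ^ 2 := by
        ext x; ring
      rw [this, integral_add (by fun_prop) (by fun_prop), integral_add (by fun_prop) (by fun_prop),
        integral_const_mul, integral_const_mul, h0]
      simp [hv]
    have hent : 3 * ε ^ 2 * v - (2 * B ^ 3 + 4 * K ^ 3) * ε ^ 3 ≤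
        ∫ x, (1 + ε * f x) ^ 2 * log ((1 + ε * f x) ^ 2) ∂μ := by
      have hcont : Continuous fun x => (1 + ε * f x) ^ 2 * log ((1 + ε * f x) ^ 2) :=
        continuous_mul_log.comp (by fun_prop : Continuous fun x => (1 + ε * f x) ^ 2)
      obtain ⟨Q, hQ⟩ := (isCompact_Icc (a := (1 / 2 : ℝ)) (b := 3 / 2)).exists_bound_of_continuousOn
        continuous_mul_log.continuousOn
      have hint : Integrable (fun x => (1 + ε * f x) ^ 2 * log ((1 + ε * f x) ^ 2)) μ :=
        Integrable.of_bound hcont.aestronglyMeasurable Q (Eventually.of_forall fun x => by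
          have h1 := abs_le.1 ((hg x).trans hεK)
          exact hQ _ ⟨by linarith [h1.1], by linarith [h1.2]⟩)
      have h1 := integral_mono (μ := μ) (by fun_prop) hint hpt
      rw [integral_sub (by fun_prop) (by fun_prop), integral_add (by fun_prop) (by fun_prop),
        integral_const_mul, integral_const_mul, h0] at h1
      simpa [hv] using h1
    have hv0 : 0 ≤ v := integral_nonneg fun x => sq_nonneg _
    have hmlog : (1 + ε ^ 2 * v) * log (1 + ε ^ 2 * v) ≤ (1 + ε ^ 2 * v) * (ε ^ 2 * v) := by
      have hp : 0 < 1 + ε ^ 2 * v := by positivity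
      exact mul_le_mul_of_nonneg_left (by linarith [log_le_sub_one_of_pos hp]) hp.le
    rw [entropySq, hder, hm] at hLSI
    have hfin : ε ^ 2 * (v - (B ^ 3 + 2 * K ^ 3) * ε - ε ^ 2 * v ^ 2 / 2) ≤ ε ^ 2 * (C * e) := by
      nlinarith
    exact le_of_mul_le_mul_left hfin (by positivity)
  have hlim : Tendsto (fun ε : ℝ => v - (B ^ 3 + 2 * K ^ 3) * ε - ε ^ 2 * v ^ 2 / 2) (𝓝[>] 0)
      (𝓝 v) := by
    have : Continuous fun ε : ℝ => v - (B ^ 3 + 2 * K ^ 3) * ε - ε ^ 2 * v ^ 2 / 2 := by fun_prop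
    have h := this.tendsto 0
    simp only [mul_zero, sub_zero, ne_eq, OfNat.ofNat_ne_zero, not_false_eq_true, zero_pow,
      zero_mul, zero_div] at h
    exact h.mono_left nhdsWithin_le_nhds
  refine le_of_tendsto hlim ?_
  have h1 : ∀ᶠ ε : ℝ in 𝓝[>] 0, ε * K < 1 / 2 := by
    have : Continuous fun ε : ℝ => ε * K := by fun_prop
    exact nhdsWithin_le_nhds ((this.tendsto 0).eventually_lt_const (by simp))
  have h2 : ∀ᶠ ε : ℝ in 𝓝[>] 0, ε < 1 :=
    nhdsWithin_le_nhds (eventually_lt_nhds one_pos)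
  filter_upwards [self_mem_nhdsWithin, h1, h2] with ε hε hεK hε1 using key ε hε hε1.le hεK.le

lemma SatisfiesLSI.poincare {μ : Measure ℝ} [IsProbabilityMeasure μ] {C : ℝ}
    (hC : SatisfiesLSI μ C) {f : ℝ → ℝ} (hf : ContDiff ℝ ∞ f) {B B' : ℝ} (hB : ∀ x, |f x| ≤ B)
    (hB' : ∀ x, |deriv f x| ≤ B') :
    ∫ x, f x ^ 2 ∂μ - (∫ x, f x ∂μ) ^ 2 ≤ C * ∫ x, (deriv f x) ^ 2 ∂μ := by
  have hfc := hf.continuous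
  have if1 : Integrable f μ := Integrable.of_bound hfc.aestronglyMeasurable B
    (Eventually.of_forall hB)
  have if2 : Integrable (fun x => f x ^ 2) μ :=
    Integrable.of_bound (hfc.pow 2).aestronglyMeasurable (B ^ 2) (Eventually.of_forall fun x => by
      rw [norm_of_nonneg (sq_nonneg _), ← sq_abs]; have := hB x; gcongr)
  set m := ∫ x, f x ∂μ with hm
  have h := SatisfiesLSI.poincare_of_integral_eq_zero hC (f := fun x => f x - m)
    (hf.sub contDiff_const) (B := B + |m|) (B' := B')
    (fun x => (abs_sub _ _).trans (by linarith [hB x]))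
    (fun x => by rw [deriv_sub_const]; exact hB' x)
    (by rw [integral_sub if1 (integrable_const _)]; simp [hm])
  simp only [deriv_sub_const] at h
  refine le_trans (le_of_eq ?_) h
  have : (fun x => (f x - m) ^ 2) = fun x => f x ^ 2 - 2 * m * f x + m ^ 2 := by ext x; ring
  rw [this, integral_add (by fun_prop) (by fun_prop), integral_sub (by fun_prop) (by fun_prop),
    integral_const_mul]
  simp only [integral_const, probReal_univ, smul_eq_mul, ← hm]
  ring

end Linearization

/-! ### Positive test functions, endpoint atoms, closeness to 1 -/

section Upper
open Real Set

/-- It suffices to test the logarithmic Sobolev inequality on positive functions. -/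
lemma satisfiesLSI_of_pos {μ : Measure ℝ} [IsFiniteMeasure μ] {C : ℝ} (hC : 0 ≤ C)
    (hpos : ∀ H H' : ℝ → ℝ, (∀ x, HasDerivAt H (H' x) x) → Continuous H' → (∀ x, 0 < H x) →
      (∃ B, ∀ x, |H x| ≤ B) → (∃ B, ∀ x, |H' x| ≤ B) →
      entropySq μ H ≤ 2 * C * ∫ x, H' x ^ 2 ∂μ) :
    SatisfiesLSI μ C := by
  intro h hh hsupp
  have hhd : Differentiable ℝ h := hh.differentiable (by simp)
  have hhc := hhd.continuous
  have hh'c : Continuous (deriv h) := hh.continuous_deriv (by simp)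
  obtain ⟨B, hB⟩ := hhc.bounded_above_of_compact_support hsupp
  obtain ⟨B', hB'⟩ := hh'c.bounded_above_of_compact_support hsupp.deriv
  have hsq : ∀ x, h x ^ 2 ≤ B ^ 2 := fun x => by
    rw [← sq_abs]; have := hB x; rw [Real.norm_eq_abs] at this; gcongr
  have hsq' : ∀ x, deriv h x ^ 2 ≤ B' ^ 2 := fun x => by
    rw [← sq_abs]; have := hB' x; rw [Real.norm_eq_abs] at this; gcongr
  -- The positive function √(h² + ε) has no more energy than h; the limit ε → 0 then removes ε.
  have key : ∀ ε : ℝ, 0 < ε →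
      (∫ x, (h x ^ 2 + ε) * log (h x ^ 2 + ε) ∂μ) -
        (∫ x, (h x ^ 2 + ε) ∂μ) * log (∫ x, (h x ^ 2 + ε) ∂μ) ≤
      2 * C * ∫ x, deriv h x ^ 2 ∂μ := by
    intro ε hε
    have hp : ∀ x, 0 < h x ^ 2 + ε := fun x => by positivity
    have hs : ∀ x, 0 < √(h x ^ 2 + ε) := fun x => sqrt_pos.2 (hp x)
    have hss : ∀ x, √(h x ^ 2 + ε) ^ 2 = h x ^ 2 + ε := fun x => sq_sqrt (hp x).le
    have hd : ∀ x, HasDerivAt (fun x => √(h x ^ 2 + ε)) (h x * deriv h x / √(h x ^ 2 + ε)) x :=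
      fun x => by
        have := (((hhd x).hasDerivAt.pow 2).add_const ε).sqrt (hp x).ne'
        refine this.congr_deriv ?_
        have := hs x
        simp only [Pi.pow_apply]
        field_simp
        norm_num
        ring
    have hle : ∀ x, (h x * deriv h x / √(h x ^ 2 + ε)) ^ 2 ≤ deriv h x ^ 2 := fun x => by
      rw [div_pow, hss, div_le_iff₀ (hp x)]
      nlinarith [mul_nonneg (sq_nonneg (deriv h x)) hε.le]
    have hcd : Continuous fun x => h x * deriv h x / √(h x ^ 2 + ε) :=
      (hhc.mul hh'c).div (by fun_prop) fun x => (hs x).ne'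
    have h1 := hpos _ _ hd hcd hs
      ⟨√(B ^ 2 + ε), fun x => by
        rw [abs_of_pos (hs x)]
        exact sqrt_le_sqrt (by linarith [hsq x])⟩
      ⟨|B'|, fun x => sq_le_sq.1 ((hle x).trans (hsq' x))⟩
    simp only [entropySq, hss] at h1
    refine h1.trans (mul_le_mul_of_nonneg_left ?_ (by positivity))
    have hi2 : Integrable (fun x => deriv h x ^ 2) μ :=
      Integrable.of_bound (hh'c.pow 2).aestronglyMeasurable (B' ^ 2)
        (Eventually.of_forall fun x => by rw [norm_of_nonneg (sq_nonneg _)]; exact hsq' x)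
    exact integral_mono (hi2.mono' (hcd.pow 2).aestronglyMeasurable
      (Eventually.of_forall fun x => by rw [norm_of_nonneg (sq_nonneg _)]; exact hle x)) hi2 hle
  obtain ⟨Q, hQ⟩ := (isCompact_Icc (a := (0 : ℝ)) (b := B ^ 2 + 1)).exists_bound_of_continuousOn
    continuous_mul_log.continuousOn
  have hev : ∀ᶠ ε : ℝ in 𝓝[>] 0, 0 < ε ∧ ε < 1 :=
    (eventually_nhdsWithin_of_forall fun ε hε => hε).and
      (nhdsWithin_le_nhds (eventually_lt_nhds one_pos))
  have hlim0 : ∀ x, Tendsto (fun ε : ℝ => h x ^ 2 + ε) (𝓝[>] 0) (𝓝 (h x ^ 2)) := fun x => by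
    have : Continuous fun ε : ℝ => h x ^ 2 + ε := by fun_prop
    have h1 := this.tendsto 0
    rw [add_zero] at h1
    exact h1.mono_left nhdsWithin_le_nhds
  have L1 : Tendsto (fun ε : ℝ => ∫ x, (h x ^ 2 + ε) ∂μ) (𝓝[>] 0) (𝓝 (∫ x, h x ^ 2 ∂μ)) := by
    refine tendsto_integral_filter_of_dominated_convergence (fun _ => B ^ 2 + 1)
      (Eventually.of_forall fun ε => Continuous.aestronglyMeasurable (by fun_prop)) ?_
      (integrable_const _) (Eventually.of_forall hlim0)
    filter_upwards [hev] with ε hε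
    refine Eventually.of_forall fun x => ?_
    rw [norm_of_nonneg (by have := hε.1; positivity)]
    linarith [hsq x, hε.2]
  have L2 : Tendsto (fun ε : ℝ => ∫ x, (h x ^ 2 + ε) * log (h x ^ 2 + ε) ∂μ) (𝓝[>] 0)
      (𝓝 (∫ x, h x ^ 2 * log (h x ^ 2) ∂μ)) := by
    refine tendsto_integral_filter_of_dominated_convergence (fun _ => Q)
      (Eventually.of_forall fun ε => (continuous_mul_log.comp
        (by fun_prop : Continuous fun x => h x ^ 2 + ε)).aestronglyMeasurable) ?_
      (integrable_const _)
      (Eventually.of_forall fun x => (continuous_mul_log.tendsto _).comp (hlim0 x))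
    filter_upwards [hev] with ε hε
    exact Eventually.of_forall fun x =>
      hQ _ ⟨by have := hε.1; positivity, by linarith [hsq x, hε.2]⟩
  exact le_of_tendsto (L2.sub ((continuous_mul_log.tendsto _).comp L1))
    (eventually_nhdsWithin_of_forall key)

/-- Sharp logarithmic Sobolev inequality for Lebesgue measure on `[a, b]` with atoms at the
endpoints. -/
lemma atoms_lsi {a b α β : ℝ} (hab : a < b) (hα : 0 ≤ α) (hβ : 0 ≤ β) {H H' : ℝ → ℝ}
    (hH : ∀ x, HasDerivAt H (H' x) x) (hH' : Continuous H') (hpos : ∀ x, 0 < H x) :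
    (∫ x in a..b, H x ^ 2 * log (H x ^ 2)) + β * (H b ^ 2 * log (H b ^ 2)) +
        α * (H a ^ 2 * log (H a ^ 2)) -
      ((∫ x in a..b, H x ^ 2) + β * H b ^ 2 + α * H a ^ 2) *
        log (((∫ x in a..b, H x ^ 2) + β * H b ^ 2 + α * H a ^ 2) / (b - a + β + α)) ≤
      2 * (b - a + β + α) ^ 2 / π ^ 2 * ∫ x in a..b, H' x ^ 2 := by
  have hHc : Continuous H := continuous_iff_continuousAt.2 fun x => (hH x).continuousAt
  -- Constant extension of H to [a - α, b + β]: the added pieces reproduce the atoms and carry no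
  -- energy. The corners at a and b explain the right derivatives and the half-open `Ico`: the right
  -- derivative is H'(a) at a and 0 at b.
  let h : ℝ → ℝ := fun x => H (max a (min b x))
  let h' : ℝ → ℝ := (Ico a b).indicator H'
  have hc : Continuous h := hHc.comp (by fun_prop)
  have hsplit : ∀ F : ℝ → ℝ, Continuous F →
      ∫ x in (a - α)..(b + β), F (h x) = (∫ x in a..b, F (H x)) + β * F (H b) + α * F (H a) := by
    intro F hF
    have hi : ∀ u v, IntervalIntegrable (fun x => F (h x)) volume u v :=
      fun u v => (hF.comp hc).intervalIntegrable _ _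
    rw [← intervalIntegral.integral_add_adjacent_intervals (hi _ a) (hi a _),
      ← intervalIntegral.integral_add_adjacent_intervals (hi a b) (hi b _)]
    have e1 : ∫ x in (a - α)..a, F (h x) = α * F (H a) := by
      rw [intervalIntegral.integral_congr (g := fun _ => F (H a))]
      · rw [intervalIntegral.integral_const, smul_eq_mul]; ring
      · intro x hx
        rw [uIcc_of_le (by linarith)] at hx
        simp only [h]
        rw [max_eq_left ((min_le_right _ _).trans hx.2)]
    have e2 : ∫ x in a..b, F (h x) = ∫ x in a..b, F (H x) := by
      refine intervalIntegral.integral_congr fun x hx => ?_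
      rw [uIcc_of_le hab.le] at hx
      simp only [h]
      rw [min_eq_right hx.2, max_eq_right hx.1]
    have e3 : ∫ x in b..(b + β), F (h x) = β * F (H b) := by
      rw [intervalIntegral.integral_congr (g := fun _ => F (H b))]
      · rw [intervalIntegral.integral_const, smul_eq_mul]; ring
      · intro x hx
        rw [uIcc_of_le (by linarith)] at hx
        simp only [h]
        rw [min_eq_left hx.1, max_eq_right hab.le]
    rw [e1, e2, e3]; ring
  have hd : ∀ x, HasDerivWithinAt h (h' x) (Ioi x) x := by
    intro x
    rcases lt_or_ge x a with hxa | hxa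
    · have : h' x = 0 := indicator_of_notMem (fun hx => absurd hx.1 (not_le.2 hxa)) _
      rw [this]
      have h1 : h =ᶠ[𝓝 x] fun _ => H a := by
        filter_upwards [Iio_mem_nhds hxa] with y hy
        simp only [h]
        rw [max_eq_left ((min_le_right _ _).trans (le_of_lt hy))]
      exact ((hasDerivAt_const x (H a)).congr_of_eventuallyEq h1).hasDerivWithinAt
    rcases lt_or_ge x b with hxb | hxb
    · have : h' x = H' x := indicator_of_mem (mem_Ico.2 ⟨hxa, hxb⟩) _
      rw [this]
      have heq : ∀ y, a ≤ y → y ≤ b → h y = H y := fun y hy1 hy2 => by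
        simp only [h]
        rw [min_eq_right hy2, max_eq_right hy1]
      refine (hH x).hasDerivWithinAt.congr_of_eventuallyEq ?_ (heq x hxa hxb.le)
      filter_upwards [Ioo_mem_nhdsGT hxb] with y hy
      exact heq y (hxa.trans hy.1.le) hy.2.le
    · have : h' x = 0 := indicator_of_notMem (fun hx => absurd hx.2 (not_lt.2 hxb)) _
      rw [this]
      have heq : ∀ y, b ≤ y → h y = H b := fun y hy => by
        simp only [h]
        rw [min_eq_left hy, max_eq_right hab.le]
      exact (hasDerivWithinAt_const x (Ioi x) (H b)).congr
        (fun y hy => heq y (hxb.trans (le_of_lt hy))) (heq x hxb)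
  have hind : (fun x => h' x ^ 2) = (Ico a b).indicator fun x => H' x ^ 2 := by
    ext x
    by_cases hx : x ∈ Ico a b <;> simp [h', hx]
  have hint : Integrable fun x => h' x ^ 2 := by
    rw [hind, integrable_indicator_iff measurableSet_Ico]
    exact (Continuous.integrableOn_Icc (by fun_prop)).mono_set Ico_subset_Icc_self
  have hAB : a - α < b + β := by linarith
  have hen : ∫ x in (a - α)..(b + β), h' x ^ 2 ≤ ∫ x in a..b, H' x ^ 2 := by
    rw [intervalIntegral.integral_of_le hAB.le, intervalIntegral.integral_of_le hab.le,
      ← integral_Ico_eq_integral_Ioc (x := a), ← integral_indicator measurableSet_Ico, ← hind]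
    exact setIntegral_le_integral hint (Eventually.of_forall fun x => sq_nonneg _)
  have hlsi := interval_lsi hAB hc (fun x => hpos _) (fun x _ => hd x) hint.integrableOn
  rw [hsplit (fun y => y ^ 2 * log (y ^ 2)) (continuous_mul_log.comp (continuous_pow 2)),
    hsplit (fun y => y ^ 2) (continuous_pow 2),
    show b + β - (a - α) = b - a + β + α by ring] at hlsi
  exact hlsi.trans (mul_le_mul_of_nonneg_left hen (by positivity))

/-- Cauchy-Schwarz, obtained by expanding the nonnegative integral of ((b - a)|H'| - I)². -/
lemma sq_sub_le_energy {a b : ℝ} (hab : a < b) {H H' : ℝ → ℝ}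
    (hH : ∀ x, HasDerivAt H (H' x) x) (hH' : Continuous H') {x y : ℝ} (hx : x ∈ Icc a b)
    (hy : y ∈ Icc a b) :
    (H x - H y) ^ 2 ≤ (b - a) * ∫ z in a..b, H' z ^ 2 := by
  have hL : 0 < b - a := sub_pos.2 hab
  set I := ∫ z in a..b, |H' z| with hI
  have h1 : |H x - H y| ≤ I := by
    have hftc : ∫ z in y..x, H' z = H x - H y :=
      intervalIntegral.integral_eq_sub_of_hasDerivAt (fun z _ => hH z)
        (hH'.intervalIntegrable _ _)
    rw [← hftc, ← Real.norm_eq_abs]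
    refine (intervalIntegral.norm_integral_le_integral_norm_uIoc).trans ?_
    rw [hI, intervalIntegral.integral_of_le hab.le]
    refine setIntegral_mono_set (Continuous.integrableOn_Ioc (by fun_prop))
      (Eventually.of_forall fun z => abs_nonneg _) (LE.le.eventuallyLE ?_)
    exact Ioc_subset_Ioc (le_min hy.1 hx.1) (max_le hy.2 hx.2)
  have h2 : 0 ≤ ∫ z in a..b, ((b - a) * |H' z| - I) ^ 2 :=
    intervalIntegral.integral_nonneg hab.le fun z _ => sq_nonneg _
  have h3 : ∫ z in a..b, ((b - a) * |H' z| - I) ^ 2 =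
      (b - a) * ((b - a) * (∫ z in a..b, H' z ^ 2) - I ^ 2) := by
    have : (fun z => ((b - a) * |H' z| - I) ^ 2) =
        fun z => (b - a) ^ 2 * H' z ^ 2 - 2 * (b - a) * I * |H' z| + I ^ 2 := by
      ext z; rw [← sq_abs (H' z)]; ring
    rw [this, intervalIntegral.integral_add (Continuous.intervalIntegrable (by fun_prop) _ _)
      (by simp), intervalIntegral.integral_sub (Continuous.intervalIntegrable (by fun_prop) _ _)
      (Continuous.intervalIntegrable (by fun_prop) _ _), intervalIntegral.integral_const_mul,
      intervalIntegral.integral_const_mul, intervalIntegral.integral_const, ← hI, smul_eq_mul]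
    ring
  rw [h3] at h2
  have h4 : 0 ≤ (b - a) * (∫ z in a..b, H' z ^ 2) - I ^ 2 := nonneg_of_mul_nonneg_right h2 hL
  have h5 : (H x - H y) ^ 2 ≤ I ^ 2 := by
    rw [← sq_abs]; gcongr
  linarith

/-- A positive function on `[a, b]` whose mean square is close to `1` and with small energy is
close to `1`. -/
lemma abs_sub_one_le_of_mean {a b α β E η : ℝ} (hab : a < b) (hα : 0 ≤ α) (hβ : 0 ≤ β)
    {H H' : ℝ → ℝ} (hH : ∀ x, HasDerivAt H (H' x) x) (hH' : Continuous H') (hpos : ∀ x, 0 < H x)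
    (hE : ∫ z in a..b, H' z ^ 2 ≤ E) (hη0 : 0 ≤ η) (hηE : η ≤ E)
    (hm : (∫ x in a..b, H x ^ 2) + β * H b ^ 2 + α * H a ^ 2 = (b - a + β + α) * (1 - η))
    {x0 : ℝ} (hx0 : x0 ∈ Icc a b) :
    |H x0 - 1| ≤ (√(b - a) + 1) * √E := by
  have hL : 0 < b - a := sub_pos.2 hab
  have hE0 : 0 ≤ E := hη0.trans hηE
  have hHc : Continuous H := continuous_iff_continuousAt.2 fun x => (hH x).continuousAt
  set k := H x0
  set D := √(b - a) * √E with hD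
  have hD0 : 0 ≤ D := by positivity
  -- H oscillates by at most D on [a, b], so the weighted mean 1 - η of H² is at most (k + D)², and
  -- at least (k - D)² when k > D. With 0 ≤ η ≤ E this confines k.
  have hosc : ∀ x ∈ Icc a b, |H x - k| ≤ D := fun x hx => by
    refine abs_le_of_sq_le_sq ?_ hD0
    refine (sq_sub_le_energy hab hH hH' hx hx0).trans ?_
    rw [hD, mul_pow, sq_sqrt hL.le, sq_sqrt hE0]
    gcongr
  have ha := left_mem_Icc.2 hab.le
  have hb := right_mem_Icc.2 hab.le
  have hk : 0 < k := hpos x0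
  have hii : IntervalIntegrable (fun x => H x ^ 2) volume a b :=
    Continuous.intervalIntegrable (by fun_prop) _ _
  have hup : ∀ x ∈ Icc a b, H x ^ 2 ≤ (k + D) ^ 2 := fun x hx => by
    have := (abs_le.1 (hosc x hx)).2
    exact pow_le_pow_left₀ (hpos x).le (by linarith) 2
  have h1 : 1 - η ≤ (k + D) ^ 2 := by
    have h2 := intervalIntegral.integral_mono_on hab.le hii
      (intervalIntegrable_const (μ := volume) (c := (k + D) ^ 2)) hup
    rw [intervalIntegral.integral_const, smul_eq_mul] at h2
    have h3 := mul_le_mul_of_nonneg_left (hup a ha) hα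
    have h4 := mul_le_mul_of_nonneg_left (hup b hb) hβ
    have h5 : (b - a + β + α) * (1 - η) ≤ (b - a + β + α) * (k + D) ^ 2 := by linarith
    exact le_of_mul_le_mul_left h5 (by linarith)
  have hsE : 0 ≤ √E := sqrt_nonneg E
  have hsE2 : √E ^ 2 = E := sq_sqrt hE0
  have hgoal : (√(b - a) + 1) * √E = D + √E := by rw [hD]; ring
  rw [hgoal, abs_le]
  constructor
  · by_contra! hlt
    have h6 : k + D < 1 - √E := by linarith
    have h7 : (k + D) ^ 2 < (1 - √E) ^ 2 := pow_lt_pow_left₀ h6 (by positivity) two_ne_zero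
    nlinarith
  · by_contra! hlt
    have h6 : 1 < k - D := by linarith
    have hlow : ∀ x ∈ Icc a b, (k - D) ^ 2 ≤ H x ^ 2 := fun x hx => by
      have := (abs_le.1 (hosc x hx)).1
      exact pow_le_pow_left₀ (by linarith) (by linarith) 2
    have h2 := intervalIntegral.integral_mono_on hab.le
      (intervalIntegrable_const (μ := volume) (c := (k - D) ^ 2)) hii hlow
    rw [intervalIntegral.integral_const, smul_eq_mul] at h2
    have h3 := mul_le_mul_of_nonneg_left (hlow a ha) hα
    have h4 := mul_le_mul_of_nonneg_left (hlow b hb) hβ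
    have h5 : (b - a + β + α) * (k - D) ^ 2 ≤ (b - a + β + α) * (1 - η) := by linarith
    have h8 := le_of_mul_le_mul_left h5 (by linarith)
    nlinarith

end Upper

/-! ### Entropy upper bound for a well -/

section WellUpper
open Real Set

/-- Rate of the error terms; it is `o(√t)`. -/
noncomputable def tailRate (t : ℝ) : ℝ := √t * √√t * (1 - log t)

/-- Allows the O(t) cost of shifting the constant `c` in `entropy_le` to be absorbed in the same
rate. -/
lemma le_tailRate {t : ℝ} (ht : 0 < t) (ht1 : t ≤ 1) : t ≤ tailRate t := by
  have h0 : log t ≤ 0 := log_nonpos ht.le ht1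
  have h1 : √t ≤ √√t := by
    refine le_sqrt_of_sq_le ?_
    rw [sq_sqrt ht.le]
    exact le_sqrt_of_sq_le (by nlinarith)
  have h2 : √t * √t ≤ √t * √√t := by gcongr
  rw [mul_self_sqrt ht.le] at h2
  have h3 : √t * √√t ≤ tailRate t := le_mul_of_one_le_right (by positivity) (by linarith)
  exact h2.trans h3

namespace WellPotential

variable {U : ℝ → ℝ} {a b κ : ℝ}

/-- Entropy is the minimum over c of ∫ (H² log(H²/c) - H² + c), by log x ≤ x - 1, and this integrand
is c(`psi`(H/√c) + 1). The freedom in c avoids normalising by the true mean, which depends on the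
tails. -/
lemma entropy_variational {t : ℝ} {H : ℝ → ℝ} {c M Z : ℝ} (hc : 0 < c) (hM : 0 < M) (hZ : 0 < Z)
    (hpos : ∀ x, 0 < H x)
    (hi1 : Integrable fun x => H x ^ 2 * log (H x ^ 2) * exp (-U x / t))
    (hi2 : Integrable fun x => H x ^ 2 * exp (-U x / t))
    (hi3 : Integrable fun x => exp (-U x / t))
    (hMd : ∫ x, H x ^ 2 * exp (-U x / t) = M) (hZd : ∫ x, exp (-U x / t) = Z) :
    (∫ x, H x ^ 2 * log (H x ^ 2) * exp (-U x / t)) - M * log (M / Z) ≤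
      c * ∫ x, (psi (H x / √c) + 1) * exp (-U x / t) := by
  have hs : √c ^ 2 = c := sq_sqrt hc.le
  have hpt : (fun x => c * ((psi (H x / √c) + 1) * exp (-U x / t))) = fun x =>
      H x ^ 2 * log (H x ^ 2) * exp (-U x / t) - (log c + 1) * (H x ^ 2 * exp (-U x / t)) +
        c * exp (-U x / t) := by
    ext x
    have h1 : log (H x ^ 2 / c) = log (H x ^ 2) - log c :=
      log_div (pow_pos (hpos x) 2).ne' hc.ne'
    rw [psi, div_pow, hs, h1]
    field_simp
    ring
  rw [← integral_const_mul, hpt, integral_add (by fun_prop) (hi3.const_mul _),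
    integral_sub hi1 (hi2.const_mul _), integral_const_mul, integral_const_mul, hMd, hZd]
  have h2 : log (c / (M / Z)) ≤ c / (M / Z) - 1 := log_le_sub_one_of_pos (by positivity)
  rw [log_div hc.ne' (by positivity)] at h2
  have h3 := mul_le_mul_of_nonneg_left h2 hM.le
  have h4 : M * (c / (M / Z) - 1) = c * Z - M := by field_simp
  linarith

/-- Asymptotic logarithmic Sobolev inequality for positive functions, unnormalized. -/
theorem entropy_le (hU : WellPotential U a b κ) {d : ℝ} (hd : 0 ≤ d) :
    ∃ K : ℝ, 0 ≤ K ∧ ∀ t : ℝ, 0 < t → t ≤ 1 → tailMass U b t ≤ d * √t →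
      tailMass (fun x => U (-x)) (-a) t ≤ d * √t →
      ∀ H H' : ℝ → ℝ, (∀ x, HasDerivAt H (H' x) x) → Continuous H' → (∀ x, 0 < H x) →
      (∃ B, ∀ x, |H x| ≤ B) → (∃ B, ∀ x, |H' x| ≤ B) →
      (∫ x, H x ^ 2 * log (H x ^ 2) * exp (-U x / t)) -
        (∫ x, H x ^ 2 * exp (-U x / t)) *
          log ((∫ x, H x ^ 2 * exp (-U x / t)) / ∫ x, exp (-U x / t)) ≤
      (2 * (∫ x, exp (-U x / t)) ^ 2 / π ^ 2 + K * tailRate t) *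
        ∫ x, H' x ^ 2 * exp (-U x / t) := by
  have hab := hU.lt
  have hL : 0 < b - a := sub_pos.2 hab
  obtain ⟨K1, hK1, hR⟩ := hU.right.tail_entropy_le
    (by positivity : 0 ≤ √(b - a) + 1) hd
  obtain ⟨K2, hK2, hLft⟩ := hU.left.tail_entropy_le
    (by positivity : 0 ≤ √(b - a) + 1) hd
  refine ⟨(b - a + d + d) + K1 + K2, by positivity, ?_⟩
  intro t ht ht1 hδb hδa H H' hH hH' hpos ⟨B, hB⟩ ⟨B', hB'⟩
  have hUc := hU.continuous
  have hHc : Continuous H := continuous_iff_continuousAt.2 fun x => (hH x).continuousAt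
  have hZ := hU.integral_exp ht
  set δb := tailMass U b t with hδbdef
  set δa := tailMass (fun x => U (-x)) (-a) t with hδadef
  have hδb0 : 0 ≤ δb := tailMass_nonneg _ _ _
  have hδa0 : 0 ≤ δa := tailMass_nonneg _ _ _
  set Z := ∫ x, exp (-U x / t) with hZdef
  have hZ0 : 0 < Z := by rw [hZ]; positivity
  have hlogt : log t ≤ 0 := log_nonpos ht.le ht1
  have hZd : Z ≤ b - a + d + d := by
    have : √t ≤ 1 := sqrt_le_one.2 ht1
    rw [hZ]; nlinarith
  -- bounded continuous functions of `H` are integrable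
  have hbd : ∀ F : ℝ → ℝ, Continuous F → ∃ Q, ∀ x, |F (H x)| ≤ Q := fun F hF => by
    obtain ⟨Q, hQ⟩ := (isCompact_Icc (a := -B) (b := B)).exists_bound_of_continuousOn
      hF.continuousOn
    exact ⟨Q, fun x => hQ _ (abs_le.1 (hB x))⟩
  have hint : ∀ F : ℝ → ℝ, Continuous F → Integrable fun x => F (H x) * exp (-U x / t) :=
    fun F hF => by
      obtain ⟨Q, hQ⟩ := hbd F hF
      exact hU.integrable_mul_exp ht (hF.comp hHc) hQ
  have hi3 := hU.integrable_exp ht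
  have hi2 := hint (fun y => y ^ 2) (continuous_pow 2)
  have hi1 := hint (fun y => y ^ 2 * log (y ^ 2)) (continuous_mul_log.comp (continuous_pow 2))
  have hiE : Integrable fun x => H' x ^ 2 * exp (-U x / t) :=
    hU.integrable_mul_exp ht (hH'.pow 2) (M := B' ^ 2) fun x => by
      rw [abs_of_nonneg (sq_nonneg _), ← sq_abs]; have := hB' x; gcongr
  set E := ∫ x, H' x ^ 2 * exp (-U x / t) with hEdef
  set M := ∫ x, H x ^ 2 * exp (-U x / t) with hMdef
  have hE0 : 0 ≤ E := integral_nonneg fun x => by positivity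
  have hM0 : 0 < M := by
    rw [hMdef, integral_pos_iff_support_of_nonneg (fun x => by positivity) hi2]
    have : Function.support (fun x => H x ^ 2 * exp (-U x / t)) = univ :=
      eq_univ_of_forall fun x => (mul_pos (pow_pos (hpos x) 2) (exp_pos _)).ne'
    rw [this]; simp
  have hEin : ∫ x in a..b, H' x ^ 2 ≤ E := by
    have h1 := hU.integral_split hiE
    rw [hEdef, h1]
    have h2 : 0 ≤ ∫ x in Ioi b, H' x ^ 2 * exp (-U x / t) := integral_nonneg fun x => by positivity
    have h3 : 0 ≤ ∫ x in Ioi (-a), H' (-x) ^ 2 * exp (-U (-x) / t) :=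
      integral_nonneg fun x => by positivity
    linarith
  have hatoms := atoms_lsi (H' := H') hab hδa0 hδb0 hH hH' hpos
  rw [← hZ] at hatoms
  set M' := (∫ x in a..b, H x ^ 2) + δb * H b ^ 2 + δa * H a ^ 2 with hM'def
  have hM'0 : 0 < M' := by
    have h1 : 0 < ∫ x in a..b, H x ^ 2 := intervalIntegral.intervalIntegral_pos_of_pos
      ((hHc.pow 2).intervalIntegrable _ _) (fun x => pow_pos (hpos x) 2) hab
    positivity
  -- M'/Z is the mean of H² when the tails are collapsed to atoms. The shift tE forces E/c ≤ 1/t, as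
  -- the tail estimate requires, and makes the collapsed mean of G² equal to 1 - t(E/c).
  set c := M' / Z + t * E with hcdef
  have hc0 : 0 < c := by positivity
  have hs0 : 0 < √c := sqrt_pos.2 hc0
  have hs2 : √c ^ 2 = c := sq_sqrt hc0.le
  have hvar := entropy_variational (U := U) (t := t) hc0 hM0 hZ0 hpos hi1 hi2 hi3
    hMdef.symm hZdef.symm
  set G : ℝ → ℝ := fun x => H x / √c with hG
  have hGd : ∀ x, HasDerivAt G (H' x / √c) x := fun x => (hH x).div_const _
  have hG'c : Continuous fun x => H' x / √c := hH'.div_const _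
  have hGpos : ∀ x, 0 < G x := fun x => div_pos (hpos x) hs0
  have hGc : Continuous G := hHc.div_const _
  have hE1 : E / c ≤ 1 / t := by
    rw [div_le_div_iff₀ hc0 ht, hcdef]
    have : 0 ≤ M' / Z := by positivity
    linarith
  have hE10 : 0 ≤ E / c := by positivity
  have hmean : (∫ x in a..b, G x ^ 2) + δb * G b ^ 2 + δa * G a ^ 2 =
      (b - a + δb + δa) * (1 - t * (E / c)) := by
    rw [← hZ]
    have h1 : ∫ x in a..b, G x ^ 2 = (∫ x in a..b, H x ^ 2) / c := by
      simp only [hG, div_pow, hs2, intervalIntegral.integral_div]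
    rw [h1]
    simp only [hG, div_pow, hs2]
    have h2 : M' = Z * (c - t * E) := by rw [hcdef]; field_simp; ring
    have h3 : (∫ x in a..b, H x ^ 2) / c + δb * (H b ^ 2 / c) + δa * (H a ^ 2 / c) = M' / c := by
      rw [hM'def]; ring
    rw [h3, h2]; field_simp
  have hclose : ∀ x0 ∈ Icc a b, |G x0 - 1| ≤ (√(b - a) + 1) * √(E / c) := fun x0 hx0 => by
    refine abs_sub_one_le_of_mean hab hδa0 hδb0 hGd hG'c hGpos ?_ (by positivity)
      (mul_le_of_le_one_left hE10 ht1) hmean hx0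
    simp only [div_pow, hs2, intervalIntegral.integral_div]
    gcongr
  have hψc : Continuous fun x => psi (G x) := continuous_psi.comp hGc
  have hψi : Integrable fun x => (psi (G x) + 1) * exp (-U x / t) :=
    hint (fun y => psi (y / √c) + 1)
      ((continuous_psi.comp (continuous_id.div_const _)).add continuous_const)
  have hψik : ∀ k, Integrable fun x => (psi (G x) - psi k) * exp (-U x / t) := fun k =>
    hint (fun y => psi (y / √c) - psi k)
      ((continuous_psi.comp (continuous_id.div_const _)).sub continuous_const)
  have hright : ∫ x in Ioi b, (psi (G x) + 1) * exp (-U x / t) ≤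
      K1 * tailRate t * (E / c) + (psi (G b) + 1) * δb := by
    have h1 : ∫ x in Ioi b, (psi (G x) - psi (G b)) * exp (-U x / t) ≤
        K1 * tailRate t * (E / c) := by
      refine le_of_tendsto (intervalIntegral_tendsto_integral_Ioi b (hψik (G b)).integrableOn
        tendsto_id) ?_
      filter_upwards [eventually_ge_atTop b] with X hX
      refine hR t ht ht1 X hX (E / c) hE10 hE1 G _ hGd hG'c hGpos ?_
        (hclose b (right_mem_Icc.2 hab.le)) ?_
      · have h2 : (fun x => (H' x / √c) ^ 2 * exp (-U x / t)) =
            fun x => H' x ^ 2 * exp (-U x / t) / c := by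
          ext x; rw [div_pow, hs2]; ring
        rw [h2, intervalIntegral.integral_div]
        gcongr
        rw [intervalIntegral.integral_of_le hX]
        exact setIntegral_le_integral hiE (Eventually.of_forall fun x => by positivity)
      · refine le_trans ?_ hδb
        rw [intervalIntegral.integral_of_le hX]
        exact setIntegral_mono_set hi3.integrableOn
          (Eventually.of_forall fun x => (exp_pos _).le) (LE.le.eventuallyLE Ioc_subset_Ioi_self)
    have h2 : (fun x => (psi (G x) + 1) * exp (-U x / t)) = fun x =>
        (psi (G x) - psi (G b)) * exp (-U x / t) + (psi (G b) + 1) * exp (-U x / t) := by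
      ext x; ring
    rw [h2, integral_add (hψik _).integrableOn (hi3.const_mul _).integrableOn,
      integral_const_mul]
    exact add_le_add h1 le_rfl
  have hleft : ∫ x in Ioi (-a), (psi (G (-x)) + 1) * exp (-U (-x) / t) ≤
      K2 * tailRate t * (E / c) + (psi (G a) + 1) * δa := by
    have h1 : ∫ x in Ioi (-a), (psi (G (-x)) - psi (G a)) * exp (-U (-x) / t) ≤
        K2 * tailRate t * (E / c) := by
      refine le_of_tendsto (intervalIntegral_tendsto_integral_Ioi (-a)
        (hψik (G a)).comp_neg.integrableOn tendsto_id) ?_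
      filter_upwards [eventually_ge_atTop (-a)] with X hX
      have := hLft t ht ht1 X hX (E / c) hE10 hE1 (fun x => G (-x)) (fun x => -(H' (-x) / √c))
        (fun x => by
          refine ((hGd (-x)).comp x (hasDerivAt_neg x)).congr_deriv (by ring))
        (hG'c.comp continuous_neg).neg (fun x => hGpos _) ?_ ?_ ?_
      · simpa only [neg_neg, id, tailRate] using this
      · have h2 : (fun x => (-(H' (-x) / √c)) ^ 2 * exp (-U (-x) / t)) =
            fun x => H' (-x) ^ 2 * exp (-U (-x) / t) / c := by
          ext x; rw [neg_sq, div_pow, hs2]; ring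
        rw [h2, intervalIntegral.integral_div]
        gcongr
        rw [intervalIntegral.integral_of_le hX, hEdef,
          ← integral_neg_eq_self fun x => H' x ^ 2 * exp (-U x / t)]
        exact setIntegral_le_integral hiE.comp_neg (Eventually.of_forall fun x => by positivity)
      · simpa only [neg_neg] using hclose a (left_mem_Icc.2 hab.le)
      · refine le_trans ?_ hδa
        rw [intervalIntegral.integral_of_le hX]
        exact setIntegral_mono_set hi3.comp_neg.integrableOn
          (Eventually.of_forall fun x => (exp_pos _).le) (LE.le.eventuallyLE Ioc_subset_Ioi_self)
    have h2 : (fun x => (psi (G (-x)) + 1) * exp (-U (-x) / t)) = fun x =>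
        (psi (G (-x)) - psi (G a)) * exp (-U (-x) / t) + (psi (G a) + 1) * exp (-U (-x) / t) := by
      ext x; ring
    rw [h2, integral_add (hψik _).comp_neg.integrableOn (hi3.comp_neg.const_mul _).integrableOn,
      integral_const_mul]
    exact add_le_add h1 le_rfl
  have hmid : ∫ x in a..b, (psi (G x) + 1) = (∫ x in a..b, psi (G x)) + (b - a) := by
    rw [intervalIntegral.integral_add (hψc.intervalIntegrable _ _) (by simp)]
    simp
  have htot : ∫ x, (psi (G x) + 1) * exp (-U x / t) ≤
      ((∫ x in a..b, psi (G x)) + δb * psi (G b) + δa * psi (G a)) + Z +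
        (K1 + K2) * tailRate t * (E / c) := by
    rw [hU.integral_split hψi, hmid, hZ]
    linarith
  -- rescaling of the entropy integrand
  have hψG : ∀ x, psi (G x) = (H x ^ 2 * log (H x ^ 2) - (log c + 1) * H x ^ 2) / c := fun x => by
    have h1 : log (H x ^ 2 / c) = log (H x ^ 2) - log c :=
      log_div (pow_pos (hpos x) 2).ne' hc0.ne'
    rw [hG, psi, div_pow, hs2, h1]
    ring
  have hbr : c * ((∫ x in a..b, psi (G x)) + δb * psi (G b) + δa * psi (G a)) =
      (∫ x in a..b, H x ^ 2 * log (H x ^ 2)) + δb * (H b ^ 2 * log (H b ^ 2)) +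
        δa * (H a ^ 2 * log (H a ^ 2)) - (log c + 1) * M' := by
    have hcl : Continuous fun x => H x ^ 2 * log (H x ^ 2) :=
      continuous_mul_log.comp (hHc.pow 2)
    simp only [hψG]
    rw [intervalIntegral.integral_div, intervalIntegral.integral_sub
      (hcl.intervalIntegrable _ _) (Continuous.intervalIntegrable (by fun_prop) _ _),
      intervalIntegral.integral_const_mul, hM'def]
    field_simp
    ring
  have hmult := mul_le_mul_of_nonneg_left htot hc0.le
  have hremc : c * ((K1 + K2) * tailRate t * (E / c)) = (K1 + K2) * tailRate t * E := by
    field_simp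
  -- The price of the shift in c is at most Z(tE)²/c, hence at most ZtE.
  have hmean2 : M' * log (M' / Z) - (log c + 1) * M' + c * Z ≤ Z * (t * E) := by
    set m := M' / Z with hm
    have hm0 : 0 < m := by positivity
    have hM'm : M' = Z * m := by rw [hm]; field_simp
    have h1 : log (m / c) ≤ m / c - 1 := log_le_sub_one_of_pos (by positivity)
    rw [log_div hm0.ne' hc0.ne'] at h1
    have h2 := mul_le_mul_of_nonneg_left h1 hm0.le
    have h3 : m * (m / c - 1) - m + c ≤ t * E := by
      have h4 : m * (m / c - 1) - m + c = (t * E) ^ 2 / c := by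
        rw [show t * E = c - m by rw [hcdef]; ring]
        field_simp
        ring
      rw [h4, div_le_iff₀ hc0, sq]
      exact mul_le_mul_of_nonneg_left (by rw [hcdef]; linarith) (by positivity)
    have h5 := mul_le_mul_of_nonneg_left (by linarith : m * (log m - log c) - m + c ≤ t * E) hZ0.le
    rw [hM'm]
    linarith
  have hEin2 : 2 * Z ^ 2 / π ^ 2 * ∫ x in a..b, H' x ^ 2 ≤ 2 * Z ^ 2 / π ^ 2 * E := by gcongr
  have hrate := le_tailRate ht ht1
  have hZtE : Z * (t * E) ≤ (b - a + d + d) * tailRate t * E := by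
    have h1 : Z * t ≤ (b - a + d + d) * tailRate t := by gcongr
    have := mul_le_mul_of_nonneg_right h1 hE0
    linarith
  have hfin : c * ((∫ x in a..b, psi (G x)) + δb * psi (G b) + δa * psi (G a)) + c * Z ≤
      2 * Z ^ 2 / π ^ 2 * E + Z * (t * E) := by
    rw [hbr]; linarith
  calc _ ≤ _ := hvar
    _ ≤ _ := hmult
    _ ≤ 2 * Z ^ 2 / π ^ 2 * E + Z * (t * E) + (K1 + K2) * tailRate t * E := by
      rw [mul_add, mul_add, hremc]; linarith
    _ ≤ _ := by linarith

end WellPotential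
end WellUpper

/-! ### Best constants and the sine test function -/

section Constants
open Real Set

lemma logSobolevConstant_le {μ : Measure ℝ} {C : ℝ} (hC : 0 ≤ C) (h : SatisfiesLSI μ C) :
    logSobolevConstant μ ≤ ENNReal.ofReal C :=
  (iInf₂_le (⟨C, hC⟩ : ℝ≥0) h).trans_eq (ENNReal.ofReal_eq_coe_nnreal hC).symm

lemma le_logSobolevConstant {μ : Measure ℝ} {l : ℝ}
    (h : ∀ C : ℝ, 0 ≤ C → SatisfiesLSI μ C → l ≤ C) :
    ENNReal.ofReal l ≤ logSobolevConstant μ :=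
  le_iInf₂ fun C hC => by
    rw [← ENNReal.ofReal_coe_nnreal]
    exact ENNReal.ofReal_le_ofReal (h C C.2 hC)

lemma entropySq_of_integral {μ : Measure ℝ} {I : (ℝ → ℝ) → ℝ} {Z : ℝ}
    (hI : ∀ F : ℝ → ℝ, ∫ x, F x ∂μ = I F / Z) (h : ℝ → ℝ) :
    entropySq μ h = (I (fun x => h x ^ 2 * log (h x ^ 2)) -
      I (fun x => h x ^ 2) * log (I (fun x => h x ^ 2) / Z)) / Z := by
  rw [entropySq, hI, hI fun x => h x ^ 2]; ring

lemma integral_uniformMeasure {a b : ℝ} (hab : a < b) (F : ℝ → ℝ) :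
    ∫ x, F x ∂(uniformMeasure a b) = (∫ x in a..b, F x) / (b - a) := by
  rw [uniformMeasure, ProbabilityTheory.cond, integral_smul_measure, Real.volume_Icc,
    ENNReal.toReal_inv, ENNReal.toReal_ofReal (by linarith), smul_eq_mul,
    intervalIntegral.integral_of_le hab.le, integral_Icc_eq_integral_Ioc, div_eq_inv_mul]

lemma isProbabilityMeasure_uniformMeasure {a b : ℝ} (hab : a < b) :
    IsProbabilityMeasure (uniformMeasure a b) :=
  ProbabilityTheory.cond_isProbabilityMeasure_of_finite (by simp [hab]) (by simp)

/-- The test function that almost saturates the Poincaré inequality. -/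
noncomputable def sineTest (a b x : ℝ) : ℝ := sin (π / (b - a) * (x - (a + b) / 2))

/-- The cosine associated with `sineTest`. -/
noncomputable def cosineTest (a b x : ℝ) : ℝ := cos (π / (b - a) * (x - (a + b) / 2))

lemma contDiff_sineTest (a b : ℝ) : ContDiff ℝ ∞ (sineTest a b) :=
  contDiff_sin.comp (contDiff_const.mul (contDiff_id.sub contDiff_const))

lemma continuous_sineTest (a b : ℝ) : Continuous (sineTest a b) := (contDiff_sineTest a b).continuous

lemma continuous_cosineTest (a b : ℝ) : Continuous (cosineTest a b) := by
  unfold cosineTest; fun_prop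

lemma continuous_cosineTest_sq (a b : ℝ) : Continuous fun x => cosineTest a b x ^ 2 :=
  (continuous_cosineTest a b).pow 2

lemma hasDerivAt_sineTest (a b x : ℝ) :
    HasDerivAt (sineTest a b) (π / (b - a) * cosineTest a b x) x := by
  refine ((hasDerivAt_sin _).comp x
    (((hasDerivAt_id x).sub_const ((a + b) / 2)).const_mul (π / (b - a)))).congr_deriv ?_
  rw [cosineTest]; simp; ring

lemma sineTest_sq (a b x : ℝ) : sineTest a b x ^ 2 = 1 - cosineTest a b x ^ 2 := by
  rw [sineTest, cosineTest, sin_sq]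

lemma abs_sineTest_le (a b x : ℝ) : |sineTest a b x| ≤ 1 := abs_sin_le_one _

lemma abs_cosineTest_le (a b x : ℝ) : |cosineTest a b x| ≤ 1 := abs_cos_le_one _

/-- This Neumann condition makes the energy of `sineTest` in the tail o(√t), although the tail mass
is of order √t. -/
lemma cosineTest_right {a b : ℝ} (hab : a < b) : cosineTest a b b = 0 := by
  have : b - a ≠ 0 := (sub_pos.2 hab).ne'
  rw [cosineTest, show π / (b - a) * (b - (a + b) / 2) = π / 2 by field_simp; ring, cos_pi_div_two]

lemma cosineTest_left {a b : ℝ} (hab : a < b) : cosineTest a b a = 0 := by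
  have : b - a ≠ 0 := (sub_pos.2 hab).ne'
  rw [cosineTest, show π / (b - a) * (a - (a + b) / 2) = -(π / 2) by field_simp; ring, cos_neg,
    cos_pi_div_two]

lemma integral_comp_test {a b : ℝ} (hab : a < b) (F : ℝ → ℝ) :
    ∫ x in a..b, F (π / (b - a) * (x - (a + b) / 2)) =
      (b - a) / π * ∫ y in (-(π / 2))..(π / 2), F y := by
  have hL : b - a ≠ 0 := (sub_pos.2 hab).ne'
  have hc : π / (b - a) ≠ 0 := div_ne_zero pi_ne_zero hL
  have h := intervalIntegral.integral_comp_mul_sub (a := a) (b := b) F hc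
    (π / (b - a) * ((a + b) / 2))
  rw [show π / (b - a) * a - π / (b - a) * ((a + b) / 2) = -(π / 2) by field_simp; ring,
    show π / (b - a) * b - π / (b - a) * ((a + b) / 2) = π / 2 by field_simp; ring,
    smul_eq_mul, inv_div] at h
  simp only [← mul_sub] at h
  exact h

lemma integral_sineTest {a b : ℝ} (hab : a < b) : ∫ x in a..b, sineTest a b x = 0 := by
  have h := integral_comp_test hab sin
  rw [integral_sin] at h
  simpa [sineTest] using h

lemma integral_cosineTest_sq {a b : ℝ} (hab : a < b) :
    ∫ x in a..b, cosineTest a b x ^ 2 = (b - a) / 2 := by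
  have h := integral_comp_test hab fun y => cos y ^ 2
  rw [integral_cos_sq] at h
  simp only [cosineTest]
  rw [h]
  simp
  field_simp

lemma deriv_sineTest_sq (a b : ℝ) : (fun x => deriv (sineTest a b) x ^ 2) =
    fun x => (π / (b - a)) ^ 2 * cosineTest a b x ^ 2 := by
  ext x; rw [(hasDerivAt_sineTest a b x).deriv, mul_pow]

lemma abs_deriv_sineTest_le (a b x : ℝ) : |deriv (sineTest a b) x| ≤ |π / (b - a)| := by
  rw [(hasDerivAt_sineTest a b x).deriv, abs_mul]
  exact mul_le_of_le_one_right (abs_nonneg _) (abs_cosineTest_le a b x)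

/-- The Poincaré inequality for `sineTest`, a consequence of a logarithmic Sobolev inequality. -/
lemma poincare_sineTest {μ : Measure ℝ} [IsProbabilityMeasure μ] {C a b : ℝ}
    (hC : SatisfiesLSI μ C) :
    1 - ∫ x, cosineTest a b x ^ 2 ∂μ - (∫ x, sineTest a b x ∂μ) ^ 2 ≤
      C * ((π / (b - a)) ^ 2 * ∫ x, cosineTest a b x ^ 2 ∂μ) := by
  have h := SatisfiesLSI.poincare hC (contDiff_sineTest a b) (abs_sineTest_le a b)
    (abs_deriv_sineTest_le a b)
  rw [deriv_sineTest_sq, integral_const_mul] at h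
  simp only [sineTest_sq] at h
  rw [integral_sub (integrable_const _) (Integrable.of_bound
    (continuous_cosineTest_sq a b).aestronglyMeasurable 1 (Eventually.of_forall fun x => by
      rw [norm_pow]; exact pow_le_one₀ (norm_nonneg _) (abs_cosineTest_le a b x)))] at h
  simpa using h

/-- The logarithmic Sobolev constant of the uniform measure on an interval. -/
theorem logSobolevConstant_uniformMeasure {a b : ℝ} (hab : a < b) :
    logSobolevConstant (uniformMeasure a b) = ENNReal.ofReal ((b - a) ^ 2 / π ^ 2) := by
  have hL : 0 < b - a := sub_pos.2 hab
  have := isProbabilityMeasure_uniformMeasure hab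
  refine le_antisymm (logSobolevConstant_le (by positivity) ?_) (le_logSobolevConstant ?_)
  · refine satisfiesLSI_of_pos (by positivity) fun H H' hH hH' hpos _ _ => ?_
    rw [entropySq_of_integral (integral_uniformMeasure hab), integral_uniformMeasure hab,
      mul_div_assoc']
    refine div_le_div_of_nonneg_right ?_ hL.le
    have h := atoms_lsi hab le_rfl le_rfl hH hH' hpos
    simp only [zero_mul, add_zero] at h
    refine h.trans_eq ?_
    ring
  · intro C _ hC
    have h := poincare_sineTest (a := a) (b := b) hC
    rw [integral_uniformMeasure hab, integral_uniformMeasure hab, integral_cosineTest_sq hab,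
      integral_sineTest hab] at h
    have h1 : (b - a) / 2 / (b - a) = 1 / 2 := by field_simp
    rw [h1] at h
    rw [div_le_iff₀ (by positivity)]
    have h2 : (π / (b - a)) ^ 2 = π ^ 2 / (b - a) ^ 2 := div_pow _ _ _
    rw [h2] at h
    have h3 : 1 ≤ C * (π ^ 2 / (b - a) ^ 2) := by norm_num at h; linarith
    rw [mul_div_assoc', le_div_iff₀ (by positivity)] at h3
    linarith

end Constants

/-! ### Two-sided bounds for Gibbs measures; tails from the hypotheses -/

section Gibbs
open Real Set

namespace WellPotential

variable {V : ℝ → ℝ} {a b κ v0 : ℝ}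

lemma gibbs_exp_eq (t x : ℝ) :
    exp (-V x / t) = exp (-v0 / t) * exp (-(V x - v0) / t) := by
  rw [← exp_add]; congr 1; ring

lemma isProbabilityMeasure_gibbs (hU : WellPotential (fun x => V x - v0) a b κ) {t : ℝ}
    (ht : 0 < t) : IsProbabilityMeasure (gibbsMeasure V t) := by
  refine isProbabilityMeasure_tilted ?_
  simp only [gibbs_exp_eq (V := V) (v0 := v0) t]
  exact (hU.integrable_exp ht).const_mul _

lemma integral_gibbs (t : ℝ) (F : ℝ → ℝ) :
    ∫ x, F x ∂(gibbsMeasure V t) =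
      (∫ x, F x * exp (-(V x - v0) / t)) / ∫ x, exp (-(V x - v0) / t) := by
  rw [gibbsMeasure, integral_tilted]
  simp only [gibbs_exp_eq (V := V) (v0 := v0) t]
  rw [integral_const_mul, ← integral_div]
  refine integral_congr_ae (Eventually.of_forall fun x => ?_)
  have := exp_pos (-v0 / t)
  simp only [smul_eq_mul]
  rw [mul_div_mul_left _ _ this.ne']
  ring

/-- Upper bound for the logarithmic Sobolev constant of Gibbs measures. -/
theorem logSobolevConstant_gibbs_le (hU : WellPotential (fun x => V x - v0) a b κ) {d : ℝ}
    (hd : 0 ≤ d) :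
    ∃ K : ℝ, 0 ≤ K ∧ ∀ t : ℝ, 0 < t → t ≤ 1 → tailMass (fun x => V x - v0) b t ≤ d * √t →
      tailMass (fun x => V (-x) - v0) (-a) t ≤ d * √t →
      logSobolevConstant (gibbsMeasure V t) ≤
        ENNReal.ofReal ((∫ x, exp (-(V x - v0) / t)) ^ 2 / π ^ 2 + K * tailRate t) := by
  obtain ⟨K, hK, h⟩ := hU.entropy_le hd
  refine ⟨K / 2, by positivity, fun t ht ht1 hb ha => ?_⟩
  have := hU.isProbabilityMeasure_gibbs ht
  have hr : 0 ≤ tailRate t := ht.le.trans (le_tailRate ht ht1)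
  have hC : 0 ≤ (∫ x, exp (-(V x - v0) / t)) ^ 2 / π ^ 2 + K / 2 * tailRate t := by positivity
  refine logSobolevConstant_le hC (satisfiesLSI_of_pos hC fun H H' hH hH' hpos hB hB' => ?_)
  rw [entropySq_of_integral (integral_gibbs (v0 := v0) t), integral_gibbs (v0 := v0),
    mul_div_assoc']
  have hZ : 0 ≤ ∫ x, exp (-(V x - v0) / t) := integral_nonneg fun x => (exp_pos _).le
  refine div_le_div_of_nonneg_right ((h t ht ht1 hb ha H H' hH hH' hpos hB hB').trans_eq ?_) hZ
  ring

/-- Lower bound for the logarithmic Sobolev constant of Gibbs measures. -/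
theorem le_logSobolevConstant_gibbs (hU : WellPotential (fun x => V x - v0) a b κ) {t : ℝ}
    (ht : 0 < t) {δ γ : ℝ}
    (hδ : δ = tailMass (fun x => V x - v0) b t + tailMass (fun x => V (-x) - v0) (-a) t)
    (hγ : γ = (∫ x in Ioi b, cosineTest a b x ^ 2 * exp (-(V x - v0) / t)) +
      ∫ x in Ioi (-a), cosineTest a b (-x) ^ 2 * exp (-(V (-x) - v0) / t)) :
    ENNReal.ofReal ((b - a) ^ 2 / π ^ 2 *
      (((b - a) / 2 + δ - γ - δ ^ 2 / (b - a)) / ((b - a) / 2 + γ))) ≤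
      logSobolevConstant (gibbsMeasure V t) := by
  have hab := hU.lt
  have hL : 0 < b - a := sub_pos.2 hab
  have := hU.isProbabilityMeasure_gibbs ht
  have hδ0 : 0 ≤ δ := by rw [hδ]; exact add_nonneg (tailMass_nonneg _ _ _) (tailMass_nonneg _ _ _)
  have hγ0 : 0 ≤ γ := by
    rw [hγ]
    exact add_nonneg (integral_nonneg fun x => by positivity)
      (integral_nonneg fun x => by positivity)
  have hZ : ∫ x, exp (-(V x - v0) / t) = (b - a) + δ := by
    rw [hU.integral_exp ht, hδ]; ring
  have hcos : ∫ x, cosineTest a b x ^ 2 * exp (-(V x - v0) / t) = (b - a) / 2 + γ := by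
    rw [hU.integral_split (hU.integrable_mul_exp ht (continuous_cosineTest_sq a b) (M := 1)
      fun x => by rw [abs_pow]; exact pow_le_one₀ (abs_nonneg _) (abs_cosineTest_le a b x)),
      integral_cosineTest_sq hab, hγ]
    ring
  -- The sine integrates to zero on [a, b], so only the tails contribute to the mean; its square is
  -- then of second order in δ.
  have hsin : |∫ x, sineTest a b x * exp (-(V x - v0) / t)| ≤ δ := by
    rw [hU.integral_split (hU.integrable_mul_exp ht (continuous_sineTest a b)
      (abs_sineTest_le a b)), integral_sineTest hab, zero_add, hδ]
    refine (abs_add_le _ _).trans (add_le_add ?_ ?_)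
    · rw [← Real.norm_eq_abs, tailMass]
      refine norm_integral_le_of_norm_le (hU.integrable_exp ht).integrableOn
        (Eventually.of_forall fun x => ?_)
      rw [norm_mul, norm_of_nonneg (exp_pos _).le]
      exact mul_le_of_le_one_left (exp_pos _).le (abs_sineTest_le a b x)
    · rw [← Real.norm_eq_abs, tailMass]
      refine norm_integral_le_of_norm_le (hU.integrable_exp ht).comp_neg.integrableOn
        (Eventually.of_forall fun x => ?_)
      rw [norm_mul, norm_of_nonneg (exp_pos _).le]
      exact mul_le_of_le_one_left (exp_pos _).le (abs_sineTest_le a b (-x))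
  refine le_logSobolevConstant fun C hC0 hC => ?_
  have h := poincare_sineTest (a := a) (b := b) hC
  rw [integral_gibbs (v0 := v0), integral_gibbs (v0 := v0), hcos, hZ] at h
  set S := ∫ x, sineTest a b x * exp (-(V x - v0) / t)
  have hS : S ^ 2 ≤ δ ^ 2 := by rw [← sq_abs]; gcongr
  have hLδ : 0 < b - a + δ := by positivity
  have h1 := mul_le_mul_of_nonneg_right h hLδ.le
  have e1 : (1 - ((b - a) / 2 + γ) / (b - a + δ) - (S / (b - a + δ)) ^ 2) * (b - a + δ) =
      (b - a) / 2 + δ - γ - S ^ 2 / (b - a + δ) := by field_simp; ring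
  have e2 : C * ((π / (b - a)) ^ 2 * (((b - a) / 2 + γ) / (b - a + δ))) * (b - a + δ) =
      C * (π / (b - a)) ^ 2 * ((b - a) / 2 + γ) := by field_simp
  rw [e1, e2] at h1
  have h2 : S ^ 2 / (b - a + δ) ≤ δ ^ 2 / (b - a) := by
    gcongr; linarith
  have hden : 0 < (b - a) / 2 + γ := by positivity
  have h3 : ((b - a) / 2 + δ - γ - δ ^ 2 / (b - a)) / ((b - a) / 2 + γ) ≤
      C * (π / (b - a)) ^ 2 := by
    rw [div_le_iff₀ hden]; linarith
  calc _ ≤ (b - a) ^ 2 / π ^ 2 * (C * (π / (b - a)) ^ 2) := by gcongr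
    _ = C := by field_simp

end WellPotential

lemma tendsto_tailRate_div_sqrt : Tendsto (fun t => tailRate t / √t) (𝓝[>] 0) (𝓝 0) := by
  have h1 : Tendsto (fun t : ℝ => t ^ (1 / 4 : ℝ) - log t * t ^ (1 / 4 : ℝ)) (𝓝[>] 0)
      (𝓝 (0 - 0)) := by
    refine Tendsto.sub ?_ (tendsto_log_mul_rpow_nhdsGT_zero (by norm_num))
    have h2 := (continuous_rpow_const (q := (1 / 4 : ℝ)) (by norm_num)).tendsto 0
    rw [zero_rpow (by norm_num)] at h2
    exact h2.mono_left nhdsWithin_le_nhds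
  rw [sub_zero] at h1
  refine h1.congr' ?_
  filter_upwards [self_mem_nhdsWithin] with t ht
  rw [mem_Ioi] at ht
  have hs : 0 < √t := sqrt_pos.2 ht
  have e : √√t = t ^ (1 / 4 : ℝ) := by
    rw [sqrt_eq_rpow, sqrt_eq_rpow, ← rpow_mul ht.le]; norm_num
  rw [tailRate, ← e]
  field_simp

/-- A Polyak-Łojasiewicz inequality produces a tail potential. -/
lemma tailPotential_of_PL {U : ℝ → ℝ} {b C : ℝ} (hd : Differentiable ℝ U) (h0 : U b = 0)
    (hC : 0 < C) (hpos : ∀ x, b < x → 0 < U x) (hPL : ∀ x, b < x → U x ≤ C * deriv U x ^ 2) :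
    TailPotential U b (1 / (2 * √C)) := by
  have hsC : 0 < √C := sqrt_pos.2 hC
  have hne : ∀ x ∈ Ioi b, deriv U x ≠ 0 := fun x hx h => by
    have h1 := hPL x hx
    rw [h] at h1
    have := hpos x hx
    norm_num at h1; linarith
  have hdpos : ∀ x ∈ Ioi b, 0 < deriv U x := by
    -- Darboux: a nowhere vanishing derivative has constant sign, with no continuity of U' needed. A
    -- negative sign would contradict U > 0 = U(b).
    rcases hasDerivWithinAt_forall_lt_or_forall_gt_of_forall_ne (convex_Ioi b)
      (fun x _ => (hd x).hasDerivAt.hasDerivWithinAt) hne with h | h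
    · exfalso
      have hanti : StrictAntiOn U (Ici b) := strictAntiOn_of_deriv_neg (convex_Ici b)
        hd.continuous.continuousOn (by rw [interior_Ici]; exact h)
      have h1 := hanti self_mem_Ici (by simp : b + 1 ∈ Ici b) (by linarith)
      have h2 := hpos (b + 1) (by linarith)
      linarith
    · exact h
  refine ⟨hd, h0, by positivity, hpos, fun x hx => ?_⟩
  have h1 : √(U x) ≤ √C * deriv U x := by
    refine sqrt_le_iff.2 ⟨(mul_pos hsC (hdpos x hx)).le, ?_⟩
    rw [mul_pow, sq_sqrt hC.le]
    exact hPL x hx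
  calc 2 * (1 / (2 * √C)) * √(U x) = √(U x) / √C := by field_simp
    _ ≤ _ := by rw [div_le_iff₀ hsC]; linarith

/-- Second order expansion at a critical point, along a set. -/
lemma tendsto_div_sq_of_contDiffOn {V : ℝ → ℝ} {x0 : ℝ} {s : Set ℝ} (hs : Convex ℝ s)
    (hx0 : x0 ∈ s) (hV : ContDiffOn ℝ 2 V s)
    (h0 : derivWithin V s x0 = 0) :
    Tendsto (fun x => (V x - V x0) / (x - x0) ^ 2) (𝓝[s \ {x0}] x0)
      (𝓝 (iteratedDerivWithin 2 V s x0 / 2)) := by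
  have h := (Real.taylor_tendsto (n := 2) hs hx0 hV).mono_left
    (nhdsWithin_mono x0 (sdiff_subset (t := {x0})))
  have h1 := h.add_const (iteratedDerivWithin 2 V s x0 / 2)
  rw [zero_add] at h1
  refine h1.congr' ?_
  filter_upwards [self_mem_nhdsWithin] with x hx
  have hne : x - x0 ≠ 0 := sub_ne_zero.2 hx.2
  rw [taylorWithinEval_succ, taylorWithinEval_succ, taylor_within_zero_eval,
    iteratedDerivWithin_one, h0]
  simp only [smul_eq_mul, mul_zero, add_zero]
  norm_num
  field_simp
  ring

end Gibbs

/-! ### Well structure of V and the numerical constant -/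

section Assembly
open Real Set

/-- Off the minimisers, the Polyak-Łojasiewicz inequality says that the derivative of √(V - min V)
stays away from zero in absolute value; the left tail is the right tail of the reflected potential.
-/
lemma wellPotential_of_PL {V : ℝ → ℝ} {a b : ℝ} (hab : a < b) (hPL : PolyakLojasiewicz V)
    (hargmin : argmin V = Icc a b) : ∃ κ, WellPotential (fun x => V x - V a) a b κ := by
  obtain ⟨hd, hbdd, C, hC⟩ := hPL
  have hmin : ∀ y, V a ≤ V y := by
    have : a ∈ argmin V := by rw [hargmin]; exact left_mem_Icc.2 hab.le
    exact this
  have hinf : ⨅ y, V y = V a := le_antisymm (ciInf_le hbdd a) (le_ciInf hmin)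
  rw [hinf] at hC
  have hpos : ∀ x, x ∉ Icc a b → 0 < V x - V a := fun x hx => by
    by_contra! h
    refine hx ?_
    rw [← hargmin]
    exact fun y => by linarith [hmin y]
  have hzero : ∀ x ∈ Icc a b, V x - V a = 0 := fun x hx => by
    rw [← hargmin] at hx
    linarith [hx a, hmin x]
  -- Enlarging the constant to `max C 1` makes it positive.
  have hC1 : ∀ x, V x - V a ≤ max C 1 * deriv V x ^ 2 := fun x =>
    (hC x).trans (mul_le_mul_of_nonneg_right (le_max_left _ _) (sq_nonneg _))
  have hCpos : 0 < max C 1 := lt_max_of_lt_right one_pos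
  refine ⟨_, hab, tailPotential_of_PL (C := max C 1) (hd.sub_const _)
      (hzero b (right_mem_Icc.2 hab.le)) hCpos
      (fun x hx => hpos x fun h => absurd h.2 (not_le.2 hx)) (fun x _ => ?_),
    tailPotential_of_PL (C := max C 1) ((hd.comp differentiable_neg).sub_const _) (by simp) hCpos
      (fun x hx => hpos (-x) fun h => absurd h.1 (by linarith)) (fun x _ => ?_), hzero⟩
  · simpa only [deriv_sub_const] using hC1 x
  · have h : deriv (fun x => V (-x) - V a) x = -deriv V (-x) := by
      rw [deriv_sub_const, deriv_comp_neg]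
    rw [h, neg_sq]
    exact hC1 (-x)

/-- Identifies one endpoint's share of the limit: 2L/π² times the Laplace coefficient of its tail
mass. -/
lemma gaussian_constant_eq {L D : ℝ} (hD : 0 < D) :
    2 * L / π ^ 2 * (√(π / (D / 2)) / 2) =
      √2 * L * π ^ (-(3 / 2) : ℝ) * D ^ (-(1 / 2) : ℝ) := by
  have hπ := pi_pos
  have h1 : √(π / (D / 2)) = √2 * √π / √D := by
    rw [show π / (D / 2) = 2 * π / D by field_simp, sqrt_div (by positivity),
      sqrt_mul (by norm_num)]
  have h2 : D ^ (-(1 / 2) : ℝ) = 1 / √D := by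
    rw [rpow_neg hD.le, ← sqrt_eq_rpow, one_div]
  have h3 : π ^ (-(3 / 2) : ℝ) = √π / π ^ 2 := by
    rw [show (-(3 / 2) : ℝ) = 1 / 2 - (2 : ℕ) by norm_num, rpow_sub_natCast hπ.ne', ← sqrt_eq_rpow]
  rw [h1, h2, h3]
  ring

end Assembly

end LogSobolevLine

/-! ### The first-order expansion of the constant -/

open LogSobolevLine

theorem theorem1p6 (V : ℝ → ℝ) (a b : ℝ) (hab : a < b)
    (hPL : PolyakLojasiewicz V)
    (hargmin : argmin V = Set.Icc a b)
    (hright : ContDiffOn ℝ 2 V (Set.Ici b))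
    (hleft : ContDiffOn ℝ 2 V (Set.Iic a))
    (hbdd : BddAbove
      ((fun x => iteratedDeriv 2 V x / (1 + (deriv V x) ^ 2)) '' (Set.Icc a b)ᶜ)) :
    (∀ t : ℝ, 0 < t → IsProbabilityMeasure (gibbsMeasure V t)) ∧
    0 < leftSecondDeriv V a ∧ 0 < rightSecondDeriv V b ∧
    logSobolevConstant (uniformMeasure a b) < ⊤ ∧
    (∀ᶠ t in 𝓝[>] (0 : ℝ), logSobolevConstant (gibbsMeasure V t) < ⊤) ∧
    Tendsto
      (fun t : ℝ =>
        ((logSobolevConstant (gibbsMeasure V t)).toReal -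
          (logSobolevConstant (uniformMeasure a b)).toReal) / Real.sqrt t)
      (𝓝[>] 0)
      (𝓝 (Real.sqrt 2 * (b - a) * Real.pi ^ (-(3 / 2) : ℝ) *
        (leftSecondDeriv V a ^ (-(1 / 2) : ℝ) +
          rightSecondDeriv V b ^ (-(1 / 2) : ℝ)))) := by
  obtain ⟨κ, hU⟩ := wellPotential_of_PL hab hPL hargmin
  have hL : 0 < b - a := sub_pos.2 hab
  have hdV : Differentiable ℝ V := hPL.1
  have hVab : V b = V a := by
    have := hU.zero b (Set.right_mem_Icc.2 hab.le); linarith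
  have hmina : ∀ y, V a ≤ V y := fun y => by have := hU.nonneg y; linarith
  have hd0 : ∀ x, V x = V a → deriv V x = 0 := fun x hx => by
    have hm : IsLocalMin V x := Filter.Eventually.of_forall fun y => by rw [hx]; exact hmina y
    exact hm.deriv_eq_zero
  have hDr : Tendsto (fun x => (V x - V a) / (x - b) ^ 2) (𝓝[>] b)
      (𝓝 (rightSecondDeriv V b / 2)) := by
    have h := tendsto_div_sq_of_contDiffOn (convex_Ici b) Set.self_mem_Ici hright
      (by rw [(hdV b).derivWithin (uniqueDiffOn_Ici b b Set.self_mem_Ici), hd0 b hVab])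
    rwa [Set.Ici_sdiff_left, hVab] at h
  have hDl : Tendsto (fun x => (V (-x) - V a) / (x - -a) ^ 2) (𝓝[>] (-a))
      (𝓝 (leftSecondDeriv V a / 2)) := by
    have h := tendsto_div_sq_of_contDiffOn (convex_Iic a) Set.self_mem_Iic hleft
      (by rw [(hdV a).derivWithin (uniqueDiffOn_Iic a a Set.self_mem_Iic), hd0 a rfl])
    rw [Set.Iic_sdiff_right] at h
    refine (h.comp tendsto_neg_nhdsGT_neg).congr fun x => ?_
    simp only [Function.comp_apply]
    congr 1; ring
  have hl0 := hU.left.pos_of_tendsto hDl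
  have hr0 := hU.right.pos_of_tendsto hDr
  set Dl := leftSecondDeriv V a
  set Dr := rightSecondDeriv V b
  set sl := √(Real.pi / (Dl / 2)) / 2 with hsl
  set sr := √(Real.pi / (Dr / 2)) / 2 with hsr
  have hsl0 : 0 ≤ sl := by positivity
  have hsr0 : 0 ≤ sr := by positivity
  set mr : ℝ → ℝ := tailMass (fun x => V x - V a) b with hmr
  set ml : ℝ → ℝ := tailMass (fun x => V (-x) - V a) (-a) with hml
  have hmrt : Tendsto (fun t => mr t / √t) (𝓝[>] 0) (𝓝 sr) := by
    have h := hU.right.tendsto_laplace hDr (continuous_const (y := (1 : ℝ))) (M := 1) (by simp)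
    simp only [one_mul] at h
    exact h
  have hmlt : Tendsto (fun t => ml t / √t) (𝓝[>] 0) (𝓝 sl) := by
    have h := hU.left.tendsto_laplace hDl (continuous_const (y := (1 : ℝ))) (M := 1) (by simp)
    simp only [one_mul] at h
    exact h
  have hcosB : ∀ x, |cosineTest a b x ^ 2| ≤ 1 := fun x => by
    rw [abs_pow]; exact pow_le_one₀ (abs_nonneg _) (abs_cosineTest_le a b x)
  set γ : ℝ → ℝ := fun t =>
    (∫ x in Set.Ioi b, cosineTest a b x ^ 2 * Real.exp (-(V x - V a) / t)) +
      ∫ x in Set.Ioi (-a), cosineTest a b (-x) ^ 2 * Real.exp (-(V (-x) - V a) / t) with hγ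
  have hγt : Tendsto (fun t => γ t / √t) (𝓝[>] 0) (𝓝 0) := by
    have h1 := hU.right.tendsto_laplace hDr (continuous_cosineTest_sq a b) hcosB
    have h2 := hU.left.tendsto_laplace hDl
      ((continuous_cosineTest_sq a b).comp continuous_neg) (fun x => hcosB (-x))
    simp only [Function.comp_apply, neg_neg, cosineTest_right hab, cosineTest_left hab] at h1 h2
    have h3 := h1.add h2
    rw [zero_pow two_ne_zero, zero_mul, zero_mul, add_zero] at h3
    exact h3.congr fun t => (add_div _ _ _).symm
  set δ : ℝ → ℝ := fun t => mr t + ml t with hδ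
  have hδt : Tendsto (fun t => δ t / √t) (𝓝[>] 0) (𝓝 (sr + sl)) :=
    (hmrt.add hmlt).congr fun t => by rw [hδ]; ring
  have hsq : Tendsto (fun t : ℝ => √t) (𝓝[>] 0) (𝓝 0) := by
    have h := Real.continuous_sqrt.tendsto 0
    rw [Real.sqrt_zero] at h
    exact h.mono_left nhdsWithin_le_nhds
  have hsqrt_pos : ∀ᶠ t : ℝ in 𝓝[>] 0, 0 < √t :=
    eventually_nhdsWithin_of_forall fun t ht => Real.sqrt_pos.2 ht
  have hunif := logSobolevConstant_uniformMeasure hab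
  -- The extra 1 gives strict room, so both tail masses are eventually at most d√t.
  set d := sr + sl + 1 with hd
  have hd_nonneg : 0 ≤ d := by positivity
  obtain ⟨K, hK, hupper⟩ := hU.logSobolevConstant_gibbs_le hd_nonneg
  have hZ : ∀ t, 0 < t → ∫ x, Real.exp (-(V x - V a) / t) = (b - a) + δ t := fun t ht => by
    rw [hU.integral_exp ht, hδ]; ring
  have hle : ∀ᶠ t : ℝ in 𝓝[>] 0, logSobolevConstant (gibbsMeasure V t) ≤
      ENNReal.ofReal (((b - a) + δ t) ^ 2 / Real.pi ^ 2 + K * tailRate t) := by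
    filter_upwards [self_mem_nhdsWithin, nhdsWithin_le_nhds (eventually_lt_nhds one_pos),
      hmrt.eventually_lt_const (by linarith : sr < d),
      hmlt.eventually_lt_const (by linarith : sl < d), hsqrt_pos] with t ht ht1 h1 h2 h3
    rw [div_lt_iff₀ h3] at h1 h2
    rw [← hZ t ht]
    exact hupper t ht ht1.le h1.le h2.le
  have hfin : ∀ᶠ t : ℝ in 𝓝[>] 0, logSobolevConstant (gibbsMeasure V t) < ⊤ :=
    hle.mono fun t ht => ht.trans_lt ENNReal.ofReal_lt_top
  refine ⟨fun t ht => hU.isProbabilityMeasure_gibbs ht, hl0, hr0,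
    by rw [hunif]; exact ENNReal.ofReal_lt_top, hfin, ?_⟩
  have hlimit : Real.sqrt 2 * (b - a) * Real.pi ^ (-(3 / 2) : ℝ) *
      (Dl ^ (-(1 / 2) : ℝ) + Dr ^ (-(1 / 2) : ℝ)) = 2 * (b - a) / Real.pi ^ 2 * (sr + sl) := by
    rw [mul_add, mul_add, ← gaussian_constant_eq hl0, ← gaussian_constant_eq hr0, add_comm]
  rw [hlimit, hunif, ENNReal.toReal_ofReal (by positivity)]
  -- This is the Poincaré lower bound minus L²/π², divided by √t and rewritten through δ/√t and
  -- γ/√t. Since γ = o(√t), its limit agrees with that of ((L + δ)² - L²)/(π²√t), the main term of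
  -- the upper bound.
  have hlow : Tendsto (fun t => (b - a) ^ 2 / Real.pi ^ 2 *
      ((δ t / √t - 2 * (γ t / √t) - (δ t / √t) ^ 2 * √t / (b - a)) /
        ((b - a) / 2 + γ t / √t * √t))) (𝓝[>] 0)
      (𝓝 (2 * (b - a) / Real.pi ^ 2 * (sr + sl))) := by
    have h := (((hδt.sub (hγt.const_mul 2)).sub
      (((hδt.pow 2).mul hsq).div_const (b - a))).div
        ((hγt.mul hsq).const_add ((b - a) / 2)) (by rw [zero_mul, add_zero]; exact (half_pos hL).ne')).const_mul
        ((b - a) ^ 2 / Real.pi ^ 2)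
    have e : (b - a) ^ 2 / Real.pi ^ 2 * ((sr + sl - 2 * 0 - (sr + sl) ^ 2 * 0 / (b - a)) /
        ((b - a) / 2 + 0 * 0)) = 2 * (b - a) / Real.pi ^ 2 * (sr + sl) := by
      simp only [mul_zero, zero_div, sub_zero, add_zero]
      field_simp
    rw [e] at h
    exact h
  have hup : Tendsto (fun t => (2 * (b - a) * (δ t / √t) + (δ t / √t) ^ 2 * √t) / Real.pi ^ 2 +
      K * (tailRate t / √t)) (𝓝[>] 0) (𝓝 (2 * (b - a) / Real.pi ^ 2 * (sr + sl))) := by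
    have h := (((hδt.const_mul (2 * (b - a))).add ((hδt.pow 2).mul hsq)).div_const
      (Real.pi ^ 2)).add (tendsto_tailRate_div_sqrt.const_mul K)
    convert h using 2
    ring
  have hδ0 : ∀ t, 0 ≤ δ t := fun t => add_nonneg (tailMass_nonneg _ _ _) (tailMass_nonneg _ _ _)
  have hγ0 : ∀ t, 0 ≤ γ t := fun t => add_nonneg (integral_nonneg fun x => by positivity)
    (integral_nonneg fun x => by positivity)
  refine tendsto_of_tendsto_of_tendsto_of_le_of_le' hlow hup ?_ ?_
  · filter_upwards [self_mem_nhdsWithin, hfin, hsqrt_pos] with t ht hft hst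
    have h := hU.le_logSobolevConstant_gibbs ht (δ := δ t) (γ := γ t) rfl rfl
    rw [ENNReal.ofReal_le_iff_le_toReal hft.ne] at h
    have hden : 0 < (b - a) / 2 + γ t := by have := hγ0 t; positivity
    obtain ⟨q, hq⟩ : ∃ q, q = (b - a) / 2 + γ t := ⟨_, rfl⟩
    have hγq : γ t = q - (b - a) / 2 := by rw [hq]; ring
    calc _ = ((b - a) ^ 2 / Real.pi ^ 2 *
          (((b - a) / 2 + δ t - γ t - δ t ^ 2 / (b - a)) / ((b - a) / 2 + γ t)) -
            (b - a) ^ 2 / Real.pi ^ 2) / √t := by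
          rw [← hq] at hden
          rw [div_mul_cancel₀ _ hst.ne', ← hq, hγq]
          field_simp
          ring
      _ ≤ _ := by gcongr
  · filter_upwards [self_mem_nhdsWithin, hle, hsqrt_pos,
      nhdsWithin_le_nhds (eventually_lt_nhds one_pos)] with t ht hlt hst ht1
    have hr : 0 ≤ tailRate t := (le_of_lt ht).trans (le_tailRate ht ht1.le)
    have h := ENNReal.toReal_le_of_le_ofReal (by positivity) hlt
    calc _ ≤ (((b - a) + δ t) ^ 2 / Real.pi ^ 2 + K * tailRate t -
          (b - a) ^ 2 / Real.pi ^ 2) / √t := by gcongr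
      _ = _ := by
        field_simp
        ring
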